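/- \textbf{Definitions.} For a graph $G$ and finite disjoint vertex sets $A,B$ let $E(A,B)$ be the set of edges of $G$ between $A$ and $B$, and $d(A,B)=|E(A,B)|/(|A||B|)$. The pair $(A,B)$ is $\varepsilon$-regular if $|d(A',B')-d(A,B)|\le\varepsilon\, d(A,B)$ for all $A'\subseteq A$, $B'\subseteq B$ with $|A'|\ge\varepsilon|A|$, $|B'|\ge\varepsilon|B|$; it is $(\varepsilon,q)$-lower-regular if $d(A',B')\ge(1-\varepsilon)q$ for all such nonempty $A',B'$. Let $P_\ell^2$ be the square of the path of length $\ell$: its vertices are $1,\dots,\ell+1$, and $i\ne j$ are adjacent iff $|i-j|\le 2$. Let $\tilde{\mathcal G}(P_\ell^2,m,q,\varepsilon)$ be the class of graphs with pairwise disjoint vertex sets $V_1,\dots,V_{\ell+1}$ of size $m$ such that for all $i,j$ with $1\le|i-j|\le2$ the pair $(V_i,V_j)$ is $\varepsilon$-regular with $(1-\varepsilon)q\le d(V_i,V_j)\le(1+\varepsilon)q$, and such that for every $i\in\{1,\dots,\ell-1\}$: (i) every edge between $V_i$ and $V_{i+1}$ closes a triangle with at least $(1-\varepsilon)mq^2$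 vertices of $V_{i+2}$; and (ii) for all but at most $\varepsilon m$ vertices $v\in V_{i+1}$ the neighbourhoods of $v$ in $V_i$ and in $V_{i+2}$ form an $(\varepsilon,q)$-lower-regular pair. An edge $e=v_1v_2$ with $v_1\in V_1$, $v_2\in V_2$ \emph{expands} to a set $E'\subseteq E(V_\ell,V_{\ell+1})$ if for every $e'\in E'$ there are vertices $v_j\in V_j$ for $3\le j\le\ell+1$ with $e'=v_\ell v_{\ell+1}$ such that $v_iv_j$ is an edge of $G$ whenever $1\le|i-j|\le2$ (that is, $v_1,\dots,v_{\ell+1}$ is the square of a path of length $\ell$ in $G$ from $e$ to $e'$). \textbf{Statement.} For every $\alpha>0$ there is $\varepsilon_0=\varepsilon_0(\alpha)>0$ such that for all $0<\varepsilon\le\varepsilon_0$, all $\eta>0$, all $0<\gamma\le1$ and all integers $k\ge 3/\gamma$ the following holds. Let $p=p(n)=n^{-1/2+\gamma/2}$. With probability tending to $1$ as $n\to\infty$, the random graph $G_{n,p}$ has this property: for every subgraph $G\subseteq G_{n,p}$ that belongs to $\tilde{\mathcal G}(P^2_{k+4},n_0,\alpha p,\varepsilon)$, with vertex sets $V_1,\dots,V_{k+5}$,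 for some $n_0\ge\eta n$, every edge of $G$ between $V_1$ and $V_2$ expands to a set of at least $0.52\cdot|E(V_{k+4},V_{k+5})|$ edges of $E(V_{k+4},V_{k+5})$. -/

import Mathlib

namespace PathExpansion

/-- The square `P_k²` of the path of length `k`: the vertices are `0, …, k`, and two distinct
vertices are adjacent when they are at distance at most two along the path. -/
def pathSquare (k : ℕ) : SimpleGraph (Fin (k + 1)) where
  Adj i j := i ≠ j ∧ (i : ℕ) ≤ j + 2 ∧ (j : ℕ) ≤ i + 2
  symm := ⟨fun _ _ h => ⟨h.1.symm, h.2.2, h.2.1⟩⟩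
  loopless := ⟨fun _ h => h.1 rfl⟩

variable {W : Type*}

open scoped Classical in
/-- `E(A, B)`, each edge being recorded as the pair (endpoint in `A`, endpoint in `B`). For disjoint
`A` and `B` this counts every edge once. -/
noncomputable def edgesBetween (G : SimpleGraph W) (A B : Finset W) : Finset (W × W) :=
  G.interedges A B

/-- `|E(A, B)| / (|A| |B|)`. -/
noncomputable def density (G : SimpleGraph W) (A B : Finset W) : ℝ :=
  ((edgesBetween G A B).card : ℝ) / ((A.card : ℝ) * (B.card : ℝ))

/-- `(ε, q)`-regularity of the bipartite graph between `A` and `B`. -/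
def IsRegularWith (G : SimpleGraph W) (ε q : ℝ) (A B : Finset W) : Prop :=
  ∀ A' ⊆ A, ∀ B' ⊆ B, ε * (A.card : ℝ) ≤ A'.card → ε * (B.card : ℝ) ≤ B'.card →
    |density G A' B' - density G A B| ≤ ε * q

/-- `ε`-regularity: `(ε, q)`-regularity where `q` is the density of the pair. -/
def IsRegular (G : SimpleGraph W) (ε : ℝ) (A B : Finset W) : Prop :=
  IsRegularWith G ε (density G A B) A B

/-- `(ε, q)`-lower-regularity of the bipartite graph between `A` and `B`. The test sets are required
to be nonempty so that the quotient in `density` makes sense. -/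
def IsLowerRegular (G : SimpleGraph W) (ε q : ℝ) (A B : Finset W) : Prop :=
  ∀ A' ⊆ A, ∀ B' ⊆ B, A'.Nonempty → B'.Nonempty →
    ε * (A.card : ℝ) ≤ A'.card → ε * (B.card : ℝ) ≤ B'.card →
    (1 - ε) * q ≤ density G A' B'

/-- `G`, with the vertex sets `V i`, belongs to the class `𝒢(F, m, q, ε)` of regular blow-ups
of `F`. -/
structure IsBlowUp {ι : Type*} (F : SimpleGraph ι) (G : SimpleGraph W) (V : ι → Finset W)
    (m : ℕ) (q ε : ℝ) : Prop where
  card_eq : ∀ i, (V i).card = m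
  disjoint : ∀ i j, i ≠ j → Disjoint (V i) (V j)
  regular : ∀ i j, F.Adj i j → IsRegular G ε (V i) (V j)
  density_ge : ∀ i j, F.Adj i j → (1 - ε) * q ≤ density G (V i) (V j)
  density_le : ∀ i j, F.Adj i j → density G (V i) (V j) ≤ (1 + ε) * q

open scoped Classical in
/-- The neighbours of `v` in `A`. -/
noncomputable def nbhdIn (G : SimpleGraph W) (v : W) (A : Finset W) : Finset W :=
  A.filter (fun x => G.Adj v x)

open scoped Classical in
/-- `G`, with the vertex sets `V 0, …, V k`, belongs to the class `𝒢̃(P_k², m, q, ε)`. -/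
structure IsTildeBlowUp (k : ℕ) (G : SimpleGraph W) (V : Fin (k + 1) → Finset W)
    (m : ℕ) (q ε : ℝ) : Prop extends IsBlowUp (pathSquare k) G V m q ε where
  /-- Every edge between `V i` and `V (i+1)` closes a triangle with at least `(1 - ε) m q²`
  vertices of `V (i+2)`. -/
  triangles : ∀ (i : ℕ) (hi : i + 2 < k + 1),
    ∀ u ∈ V ⟨i, by omega⟩, ∀ w ∈ V ⟨i + 1, by omega⟩, G.Adj u w →
      (1 - ε) * (m : ℝ) * q ^ 2 ≤
        (((V ⟨i + 2, hi⟩).filter (fun x => G.Adj u x ∧ G.Adj w x)).card : ℝ)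
  /-- All but at most `ε m` vertices of `V (i+1)` have neighbourhoods into `V i` and `V (i+2)`
  that induce an `(ε, q)`-lower-regular graph. -/
  lowerRegular : ∀ (i : ℕ) (hi : i + 2 < k + 1),
    (((V ⟨i + 1, by omega⟩).filter (fun v =>
      ¬ IsLowerRegular G ε q (nbhdIn G v (V ⟨i, by omega⟩))
        (nbhdIn G v (V ⟨i + 2, hi⟩)))).card : ℝ) ≤ ε * (m : ℝ)

/-- The edge `e` between `V 0` and `V 1` expands to the set `E'` of edges between `V k` and
`V (k+1)`: for every `e' ∈ E'` some copy in `G` of the square of the path of length `k + 1`, with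
its `j`-th vertex in `V j`, starts with the edge `e` and ends with the edge `e'`. -/
def Expands {k : ℕ} (G : SimpleGraph W) (V : Fin (k + 2) → Finset W) (e : W × W)
    (E' : Finset (W × W)) : Prop :=
  ∀ e' ∈ E', ∃ f : (pathSquare (k + 1)).Copy G, (∀ j, f j ∈ V j) ∧
    e = (f 0, f 1) ∧ e' = (f (Fin.last k).castSucc, f (Fin.last (k + 1)))

end PathExpansion

namespace PathExpansion

open MeasureTheory Filter Topology
open scoped ENNReal unitInterval

/-! The only random input is an upper bound on edge counts. For D = n^δ with δ small, with high
probability e(A,B) ≤ 2p|A||B| + D(|A|+|B|) for all disjoint A, B, and every degree is at most 2pn +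
D. These bounds pass to subgraphs, so everything after them is deterministic.

Fix the starting edge and let s_j be the number of pairs in V_j × V_{j+1} reached from it. If v is
reached from a vertices and leads on to b vertices, then each of the a edges into v closes at least
d ≈ n₀(αp)² triangles, whose apexes lie among those b vertices. Hence da ≤ 2pab + D(a+b). So b ≥
da/(6L) as long as pa ≤ L, where L = D² (v is unsaturated), and b ≥ d/(6p) as soon as pa ≥ D (v is
saturated).

Applied twice, this gives `growth_or_manyOut`: within two steps either s_j grows by a factor g of
order n^(γ-2δ), or a positive proportion of the vertices has out-degree of order pn₀. The first two
steps always grow, since in-degrees are still at most 1, so s_j² ≥ g^(j+2) along the way. Growth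
requires s_j = O(nL/p), and kγ ≥ 3 makes g^k exceed the square of this, so the dense alternative
occurs within k+1 steps (`exists_manyOut_reach`).

From there regularity takes over. Lower-regularity of neighbourhoods means that a vertex entered
along an ε-fraction of its backward edges leaves along all but an ε-fraction of its forward ones.
Two steps bring this to all but 10εm vertices, and it persists to the end (`nearlyFull_reach`),
which is far more than the fraction 0.52. -/

lemma mem_edgesBetween {W : Type*} {G : SimpleGraph W} {A B : Finset W} {x : W × W} :
    x ∈ edgesBetween G A B ↔ x.1 ∈ A ∧ x.2 ∈ B ∧ G.Adj x.1 x.2 := by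
  classical
  simp [edgesBetween, SimpleGraph.interedges, Rel.mem_interedges_iff]

/-! ### Edge counts in the binomial random graph -/

/-- The event is a cylinder, so independence gives a product over unordered pairs; injectivity keeps
the pairs of J distinct. Only an inequality holds, because a diagonal pair is never an edge. -/
lemma binomialRandom_forall_adj_le {W : Type*} [Countable W] (p : I) (J : Finset (W × W))
    (hJ : Set.InjOn (fun e : W × W => s(e.1, e.2)) J) :
    SimpleGraph.binomialRandom W p {H | ∀ e ∈ J, H.Adj e.1 e.2} ≤
      ENNReal.ofReal (p : ℝ) ^ J.card := by
  classical
  rw [SimpleGraph.binomialRandom_apply]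
  have hsub : (fun (G : SimpleGraph W) (e : Sym2 W) => e ∈ G.edgeSet) ''
      {H | ∀ e ∈ J, H.Adj e.1 e.2} ⊆
      ((J.image (fun e : W × W => s(e.1, e.2)) : Finset (Sym2 W)) : Set (Sym2 W)).pi
        (fun _ => ({True} : Set Prop)) := by
    rintro _ ⟨H, hH, rfl⟩ e he
    simp only [Finset.coe_image, Set.mem_image, Finset.mem_coe] at he
    obtain ⟨x, hx, rfl⟩ := he
    simpa using hH x hx
  refine (measure_mono hsub).trans ?_
  rw [Measure.infinitePi_pi _ (fun _ _ => MeasurableSet.of_discrete)]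
  have hcard : (J.image (fun e : W × W => s(e.1, e.2))).card = J.card :=
    Finset.card_image_of_injOn hJ
  rw [← hcard]
  refine Finset.prod_le_pow_card _ _ _ fun e _ => ?_
  have hp : (unitInterval.toNNReal p : ℝ≥0∞) = ENNReal.ofReal (p : ℝ) := by
    rw [ENNReal.ofReal, Real.toNNReal_of_nonneg p.2.1]; rfl
  simp only [Measure.coe_add, Measure.coe_nnreal_smul_apply, Pi.add_apply]
  rw [hp, Measure.dirac_apply' _ MeasurableSet.of_discrete,
    Measure.dirac_apply' _ MeasurableSet.of_discrete]
  by_cases h : e.IsDiag <;> simp [h]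

lemma measurableSet_forall_adj {W : Type*} (J : Finset (W × W)) :
    MeasurableSet {H : SimpleGraph W | ∀ e ∈ J, H.Adj e.1 e.2} := by
  have : {H : SimpleGraph W | ∀ e ∈ J, H.Adj e.1 e.2} =
      ⋂ e ∈ J, {H : SimpleGraph W | H.Adj e.1 e.2} := by
    ext; simp
  rw [this]
  refine Finset.measurableSet_biInter _ fun e _ => ?_
  exact measurableSet_setOfPred.2 (by fun_prop)

/-- Chernoff bound for the number of edges between two disjoint sets. -/
lemma binomialRandom_card_edgesBetween_gt_le {W : Type*} [Countable W] (p : I)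
    {A B : Finset W} (hAB : Disjoint A B) (y : ℝ) :
    SimpleGraph.binomialRandom W p {H | 2 * (p : ℝ) * (A.card * B.card) + y <
      ((edgesBetween H A B).card : ℝ)} ≤ ENNReal.ofReal ((2 : ℝ) ^ (-y)) := by
  classical
  set μ := SimpleGraph.binomialRandom W p
  have hinj : Set.InjOn (fun e : W × W => s(e.1, e.2)) (A ×ˢ B : Finset (W × W)) := by
    rintro ⟨a, b⟩ h ⟨a', b'⟩ h' he
    simp only [Finset.coe_product, Set.mem_prod, Finset.mem_coe] at h h'
    simp only [Sym2.eq_iff] at he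
    rcases he with ⟨rfl, rfl⟩ | ⟨rfl, rfl⟩
    · rfl
    · exact absurd h'.2 (Finset.disjoint_left.1 hAB h.1)
  -- This is 2^e(A,B) written as a sum over sets of edges, so that its mean needs only the
  -- probabilities that given pairs are all edges. Markov's inequality then finishes.
  let F : SimpleGraph W → ℝ≥0∞ := fun H => ∑ J ∈ (A ×ˢ B).powerset,
    Set.indicator {H : SimpleGraph W | ∀ e ∈ J, H.Adj e.1 e.2} 1 H
  have hF : ∀ H, F H = 2 ^ (edgesBetween H A B).card := by
    intro H
    have h1 : F H = (((A ×ˢ B).powerset.filter fun J => ∀ e ∈ J, H.Adj e.1 e.2).card : ℝ≥0∞) := by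
      simp only [F, Set.indicator_apply, Set.mem_ofPred_eq, Pi.one_apply, Finset.sum_boole]
    have h2 : (A ×ˢ B).powerset.filter (fun J => ∀ e ∈ J, H.Adj e.1 e.2) =
        (edgesBetween H A B).powerset := by
      ext J
      simp only [Finset.mem_filter, Finset.mem_powerset, Finset.subset_iff, Finset.mem_product,
        mem_edgesBetween]
      constructor
      · rintro ⟨h, h'⟩ x hx
        exact ⟨(h hx).1, (h hx).2, h' x hx⟩
      · intro h
        exact ⟨fun x hx => ⟨(h hx).1, (h hx).2.1⟩, fun x hx => (h hx).2.2⟩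
    rw [h1, h2, Finset.card_powerset]; norm_num
  have hFm : Measurable F := by
    refine Finset.measurable_sum _ fun J _ => ?_
    exact measurable_one.indicator (measurableSet_forall_adj J)
  have hint : ∫⁻ H, F H ∂μ ≤ ENNReal.ofReal ((2 : ℝ) ^ (2 * (p : ℝ) * (A.card * B.card))) := by
    calc ∫⁻ H, F H ∂μ = ∑ J ∈ (A ×ˢ B).powerset,
          μ {H : SimpleGraph W | ∀ e ∈ J, H.Adj e.1 e.2} := by
          rw [lintegral_finsetSum _
            fun J _ => measurable_one.indicator (measurableSet_forall_adj J)]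
          exact Finset.sum_congr rfl fun J _ => lintegral_indicator_one (measurableSet_forall_adj J)
      _ ≤ ∑ J ∈ (A ×ˢ B).powerset, ENNReal.ofReal (p : ℝ) ^ J.card := by
          refine Finset.sum_le_sum fun J hJ => binomialRandom_forall_adj_le p J ?_
          exact hinj.mono (by exact_mod_cast Finset.mem_powerset.1 hJ)
      _ = (ENNReal.ofReal (p : ℝ) + 1) ^ (A ×ˢ B).card := by
          rw [← Finset.sum_pow_mul_eq_add_pow]; simp
      _ = ENNReal.ofReal (((p : ℝ) + 1) ^ (A.card * B.card)) := by
          rw [ENNReal.ofReal_pow (by linarith [p.2.1]), ENNReal.ofReal_add p.2.1 zero_le_one,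
            Finset.card_product, ENNReal.ofReal_one]
      _ ≤ _ := by
          refine ENNReal.ofReal_le_ofReal ?_
          -- The factor 2 in the bound comes from here: 1 + p ≤ e^p ≤ 4^p.
          have h4 : (p : ℝ) + 1 ≤ (2 : ℝ) ^ (2 * (p : ℝ)) := by
            refine (Real.add_one_le_exp _).trans ?_
            rw [Real.rpow_def_of_pos two_pos]
            refine Real.exp_le_exp.2 ?_
            have := Real.log_two_gt_d9
            nlinarith [p.2.1]
          calc ((p : ℝ) + 1) ^ (A.card * B.card) ≤ ((2 : ℝ) ^ (2 * (p : ℝ))) ^ (A.card * B.card) :=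
                pow_le_pow_left₀ (by linarith [p.2.1]) h4 _
            _ = _ := by
                rw [← Real.rpow_natCast, ← Real.rpow_mul two_pos.le]; push_cast; ring_nf
  set x : ℝ := 2 * (p : ℝ) * (A.card * B.card)
  have hmark := mul_meas_ge_le_lintegral (μ := μ) hFm (ENNReal.ofReal ((2 : ℝ) ^ (x + y)))
  have hsub : {H | x + y < ((edgesBetween H A B).card : ℝ)} ⊆
      {H | ENNReal.ofReal ((2 : ℝ) ^ (x + y)) ≤ F H} := by
    intro H hH
    simp only [Set.mem_ofPred_eq] at hH ⊢
    rw [hF]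
    have h5 : (2 : ℝ≥0∞) ^ (edgesBetween H A B).card =
        ENNReal.ofReal ((2 : ℝ) ^ ((edgesBetween H A B).card : ℝ)) := by
      rw [Real.rpow_natCast, ENNReal.ofReal_pow two_pos.le]; norm_num
    rw [h5]
    exact ENNReal.ofReal_le_ofReal (Real.rpow_le_rpow_of_exponent_le one_le_two hH.le)
  have hpos : (0 : ℝ) < (2 : ℝ) ^ (x + y) := Real.rpow_pos_of_pos two_pos _
  have key : ENNReal.ofReal ((2 : ℝ) ^ (x + y)) *
      μ {H | x + y < ((edgesBetween H A B).card : ℝ)} ≤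
      ENNReal.ofReal ((2 : ℝ) ^ (x + y)) * ENNReal.ofReal ((2 : ℝ) ^ (-y)) := by
    rw [← ENNReal.ofReal_mul hpos.le, ← Real.rpow_add two_pos]
    simp only [add_neg_cancel_right]
    exact (mul_le_mul_right (measure_mono hsub) _).trans (hmark.trans hint)
  exact (ENNReal.mul_le_mul_iff_right (by simpa using hpos) ENNReal.ofReal_ne_top).1 key

/-- Upper bounds on all edge counts and degrees that hold in random graphs. -/
structure EdgeBounded {W : Type*} [Fintype W] (H : SimpleGraph W) (p D : ℝ) : Prop where
  card_edges_le : ∀ A B : Finset W, Disjoint A B →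
    ((edgesBetween H A B).card : ℝ) ≤ 2 * p * (A.card * B.card) + D * (A.card + B.card)
  degree_le : ∀ (v : W) (A : Finset W), v ∉ A →
    ((edgesBetween H {v} A).card : ℝ) ≤ 2 * p * Fintype.card W + D

/-- Union bound. The tail 2^(-D(|A|+|B|)) factorises, so summing over pairs of nonempty sets gives a
square; the last term accounts for the n stars. -/
lemma binomialRandom_not_edgeBounded_le {n : ℕ} (p : I) {D : ℝ} (hD : 0 ≤ D) :
    SimpleGraph.binomialRandom (Fin n) p {H | ¬ EdgeBounded H (p : ℝ) D} ≤
      ENNReal.ofReal (((1 + (2 : ℝ) ^ (-D)) ^ n - 1) ^ 2 + n * (2 : ℝ) ^ (-D)) := by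
  classical
  set μ := SimpleGraph.binomialRandom (Fin n) p
  set x : ℝ := (2 : ℝ) ^ (-D) with hx
  have hx0 : 0 < x := Real.rpow_pos_of_pos two_pos _
  -- Empty sets satisfy the bound trivially, and they must be left out: each would contribute the
  -- term x^0 = 1.
  let N : Finset (Finset (Fin n)) := Finset.univ.erase ∅
  have hsub : {H : SimpleGraph (Fin n) | ¬ EdgeBounded H (p : ℝ) D} ⊆
      (⋃ P ∈ (N ×ˢ N).filter (fun P => Disjoint P.1 P.2),
        {H | 2 * (p : ℝ) * (P.1.card * P.2.card) + D * (P.1.card + P.2.card) <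
          ((edgesBetween H P.1 P.2).card : ℝ)}) ∪
      (⋃ v ∈ (Finset.univ : Finset (Fin n)),
        {H | 2 * (p : ℝ) * (({v} : Finset (Fin n)).card * (Finset.univ.erase v).card) + D <
          ((edgesBetween H {v} (Finset.univ.erase v)).card : ℝ)}) := by
    intro H hH
    by_contra hcon
    simp only [Set.mem_union, Set.mem_iUnion, not_or, not_exists, Set.mem_ofPred_eq, not_lt,
      Finset.mem_filter, Finset.mem_product, Finset.mem_univ, forall_true_left] at hcon
    refine hH ⟨fun A B hAB => ?_, fun v A hv => ?_⟩
    · by_cases hA : A = ∅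
      · subst hA
        have : edgesBetween H ∅ B = ∅ := by ext; simp [mem_edgesBetween]
        rw [this]; simp; positivity
      by_cases hB : B = ∅
      · subst hB
        have : edgesBetween H A ∅ = ∅ := by ext; simp [mem_edgesBetween]
        rw [this]; simp; positivity
      exact hcon.1 (A, B) ⟨⟨by simp [N, hA], by simp [N, hB]⟩, hAB⟩
    · have h1 := hcon.2 v
      have h2 : edgesBetween H {v} A ⊆ edgesBetween H {v} (Finset.univ.erase v) := by
        intro e he
        simp only [mem_edgesBetween, Finset.mem_singleton, Finset.mem_erase] at he ⊢
        exact ⟨he.1, ⟨fun h => hv (h ▸ he.2.1), Finset.mem_univ _⟩, he.2.2⟩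
      have h3 : ((edgesBetween H {v} A).card : ℝ) ≤
          ((edgesBetween H {v} (Finset.univ.erase v)).card : ℝ) := by
        exact_mod_cast Finset.card_le_card h2
      have h4 : ((Finset.univ.erase v).card : ℝ) ≤ Fintype.card (Fin n) := by
        exact_mod_cast Finset.card_le_univ _
      have hp := p.2.1
      simp only [Finset.card_singleton, Nat.cast_one, one_mul] at h1
      nlinarith
  refine (measure_mono hsub).trans ((measure_union_le _ _).trans ?_)
  rw [ENNReal.ofReal_add (by positivity) (by positivity)]
  refine add_le_add ?_ ?_
  · refine (measure_biUnion_finset_le _ _).trans ?_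
    have hsum : ∑ A ∈ N, x ^ A.card = (1 + x) ^ n - 1 := by
      have h1 := Finset.sum_pow_mul_eq_add_pow x 1 (Finset.univ : Finset (Fin n))
      simp only [one_pow, mul_one, Finset.powerset_univ, Finset.card_univ, Fintype.card_fin] at h1
      rw [← Finset.add_sum_erase _ _ (Finset.mem_univ ∅)] at h1
      simp only [Finset.card_empty, pow_zero] at h1
      rw [add_comm 1 x, ← h1]; simp [N]
    calc _ ≤ ∑ P ∈ (N ×ˢ N).filter (fun P => Disjoint P.1 P.2),
          ENNReal.ofReal (x ^ P.1.card * x ^ P.2.card) := by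
          refine Finset.sum_le_sum fun P hP => ?_
          refine (binomialRandom_card_edgesBetween_gt_le p (Finset.mem_filter.1 hP).2 _).trans_eq ?_
          congr 1
          rw [hx, ← Real.rpow_natCast, ← Real.rpow_natCast, ← Real.rpow_mul two_pos.le,
            ← Real.rpow_mul two_pos.le, ← Real.rpow_add two_pos]
          congr 1; ring
      _ ≤ ∑ P ∈ N ×ˢ N, ENNReal.ofReal (x ^ P.1.card * x ^ P.2.card) :=
          Finset.sum_le_sum_of_subset (Finset.filter_subset _ _)
      _ = ENNReal.ofReal (∑ P ∈ N ×ˢ N, x ^ P.1.card * x ^ P.2.card) := by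
          rw [ENNReal.ofReal_sum_of_nonneg]; intros; positivity
      _ = _ := by
          rw [Finset.sum_product, ← hsum, sq, Finset.sum_mul_sum]
  · refine (measure_biUnion_finset_le _ _).trans ?_
    calc _ ≤ ∑ v ∈ (Finset.univ : Finset (Fin n)), ENNReal.ofReal x := by
          refine Finset.sum_le_sum fun v _ => ?_
          exact binomialRandom_card_edgesBetween_gt_le p (by simp) _
      _ = _ := by
          rw [Finset.sum_const, Finset.card_univ, Fintype.card_fin, nsmul_eq_mul,
            ENNReal.ofReal_mul (by positivity), ENNReal.ofReal_natCast]

/-- Random graphs are `EdgeBounded` with high probability. -/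
theorem tendsto_binomialRandom_of_edgeBounded (p : ℕ → I) {δ : ℝ} (hδ : 0 < δ)
    (E : (n : ℕ) → Set (SimpleGraph (Fin n)))
    (hE : ∀ᶠ n : ℕ in atTop, ∀ H : SimpleGraph (Fin n),
      EdgeBounded H (p n : ℝ) ((n : ℝ) ^ δ) → H ∈ E n) :
    Tendsto (fun n => SimpleGraph.binomialRandom (Fin n) (p n) (E n)) atTop (𝓝 1) := by
  have hlim0 : Tendsto (fun n : ℕ => (n : ℝ) * (2 : ℝ) ^ (-((n : ℝ) ^ δ))) atTop (𝓝 0) := by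
    have h1 : Tendsto (fun y : ℝ => y ^ (1 / δ) * Real.exp (-Real.log 2 * y)) atTop (𝓝 0) :=
      tendsto_rpow_mul_exp_neg_mul_atTop_nhds_zero _ _ (Real.log_pos one_lt_two)
    have h2 : Tendsto (fun n : ℕ => (n : ℝ) ^ δ) atTop atTop :=
      (tendsto_rpow_atTop hδ).comp tendsto_natCast_atTop_atTop
    refine (h1.comp h2).congr fun n => ?_
    simp only [Function.comp]
    rw [← Real.rpow_mul (Nat.cast_nonneg n), mul_one_div_cancel hδ.ne', Real.rpow_one,
      Real.rpow_def_of_pos two_pos]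
    ring_nf
  have hlim : Tendsto (fun n : ℕ => ENNReal.ofReal
      (((1 + (2 : ℝ) ^ (-((n : ℝ) ^ δ))) ^ n - 1) ^ 2 + n * (2 : ℝ) ^ (-((n : ℝ) ^ δ))))
      atTop (𝓝 0) := by
    rw [← ENNReal.ofReal_zero]
    refine ENNReal.tendsto_ofReal ?_
    have h3 : Tendsto (fun n : ℕ => (1 + (2 : ℝ) ^ (-((n : ℝ) ^ δ))) ^ n) atTop (𝓝 1) := by
      refine tendsto_of_tendsto_of_tendsto_of_le_of_le tendsto_const_nhds
        (g := fun _ => 1) (h := fun n : ℕ => Real.exp ((n : ℝ) * (2 : ℝ) ^ (-((n : ℝ) ^ δ)))) ?_ ?_ ?_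
      · simpa [Function.comp_def] using (Real.continuous_exp.tendsto 0).comp hlim0
      · intro n
        exact one_le_pow₀ (by linarith [Real.rpow_pos_of_pos two_pos (-((n : ℝ) ^ δ))])
      · intro n
        simp only
        rw [Real.exp_nat_mul]
        refine pow_le_pow_left₀ (by positivity) ?_ _
        rw [add_comm]
        exact Real.add_one_le_exp _
    simpa using ((h3.sub_const 1).pow 2).add hlim0
  have hlow : Tendsto (fun n : ℕ => 1 - ENNReal.ofReal
      (((1 + (2 : ℝ) ^ (-((n : ℝ) ^ δ))) ^ n - 1) ^ 2 + n * (2 : ℝ) ^ (-((n : ℝ) ^ δ))))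
      atTop (𝓝 1) := by
    simpa using ENNReal.Tendsto.sub tendsto_const_nhds hlim (Or.inl ENNReal.one_ne_top)
  refine tendsto_of_tendsto_of_tendsto_of_le_of_le' hlow tendsto_const_nhds ?_
    (Eventually.of_forall fun n => prob_le_one)
  filter_upwards [hE] with n hn
  rw [tsub_le_iff_right]
  calc (1 : ℝ≥0∞) = SimpleGraph.binomialRandom (Fin n) (p n) Set.univ := measure_univ.symm
    _ ≤ SimpleGraph.binomialRandom (Fin n) (p n)
        (E n ∪ {H | ¬ EdgeBounded H (p n : ℝ) ((n : ℝ) ^ δ)}) := by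
        refine measure_mono fun H _ => ?_
        by_cases h : EdgeBounded H (p n : ℝ) ((n : ℝ) ^ δ)
        · exact Or.inl (hn H h)
        · exact Or.inr h
    _ ≤ _ := (measure_union_le _ _).trans
        (add_le_add le_rfl (binomialRandom_not_edgeBounded_le (p n) (by positivity)))

end PathExpansion

namespace PathExpansion

open scoped Classical

/-! ### Counting pairs of a relation -/

section Counting

variable {W : Type*}

/-- The elements of `A` related to `v`. -/
noncomputable def inN (S : W → W → Prop) (A : Finset W) (v : W) : Finset W :=
  A.filter fun u => S u v

/-- The elements of `B` that `u` is related to. -/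
noncomputable def outN (S : W → W → Prop) (B : Finset W) (u : W) : Finset W :=
  B.filter fun v => S u v

/-- The number of related pairs in `A × B`. -/
noncomputable def relCard (S : W → W → Prop) (A B : Finset W) : ℕ :=
  ((A ×ˢ B).filter fun e => S e.1 e.2).card

lemma mem_inN {S : W → W → Prop} {A : Finset W} {u v : W} : u ∈ inN S A v ↔ u ∈ A ∧ S u v := by
  simp [inN]

lemma mem_outN {S : W → W → Prop} {B : Finset W} {u v : W} : v ∈ outN S B u ↔ v ∈ B ∧ S u v := by
  simp [outN]

lemma relCard_eq_sum_out (S : W → W → Prop) (A B : Finset W) :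
    (relCard S A B : ℝ) = ∑ u ∈ A, ((outN S B u).card : ℝ) := by
  rw [relCard, Finset.card_filter, Finset.sum_product]
  push_cast
  refine Finset.sum_congr rfl fun u _ => ?_
  rw [outN, Finset.card_filter]; push_cast; rfl

lemma relCard_eq_sum_in (S : W → W → Prop) (A B : Finset W) :
    (relCard S A B : ℝ) = ∑ v ∈ B, ((inN S A v).card : ℝ) := by
  rw [relCard, Finset.card_filter, Finset.sum_product_right]
  push_cast
  refine Finset.sum_congr rfl fun u _ => ?_
  rw [inN, Finset.card_filter]; push_cast; rfl

lemma relCard_mono {S S' : W → W → Prop} {A A' B B' : Finset W} (hA : A ⊆ A') (hB : B ⊆ B')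
    (h : ∀ u ∈ A, ∀ v ∈ B, S u v → S' u v) : (relCard S A B : ℝ) ≤ relCard S' A' B' := by
  refine Nat.cast_le.2 (Finset.card_le_card fun e he => ?_)
  simp only [Finset.mem_filter, Finset.mem_product] at he ⊢
  exact ⟨⟨hA he.1.1, hB he.1.2⟩, h _ he.1.1 _ he.1.2 he.2⟩

lemma card_edgesBetween (G : SimpleGraph W) (A B : Finset W) :
    (edgesBetween G A B).card = relCard G.Adj A B := by
  rw [relCard]
  congr 1

lemma relCard_singleton_left (S : W → W → Prop) (u : W) (B : Finset W) :
    (relCard S {u} B : ℝ) = (outN S B u).card := by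
  rw [relCard_eq_sum_out, Finset.sum_singleton]

end Counting

variable {W : Type*}

/-! ### One step along the square of a path -/

/-- The pairs `(v, w)` with `w ∈ C` that extend a pair `(u, v)` of `S` to a triangle `u v w`. -/
def nextRel (G : SimpleGraph W) (C : Finset W) (S : W → W → Prop) (v w : W) : Prop :=
  w ∈ C ∧ G.Adj v w ∧ ∃ u, S u v ∧ G.Adj u w

lemma nextRel_mono {G : SimpleGraph W} {C : Finset W} {S S' : W → W → Prop}
    (h : ∀ u v, S u v → S' u v) {v w : W} (hvw : nextRel G C S v w) : nextRel G C S' v w :=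
  ⟨hvw.1, hvw.2.1, hvw.2.2.imp fun _ hu => ⟨h _ _ hu.1, hu.2⟩⟩

/-- Every edge between `A` and `B` closes at least `d` triangles with vertices of `C`. -/
def ClosesTriangles (G : SimpleGraph W) (A B C : Finset W) (d : ℝ) : Prop :=
  ∀ u ∈ A, ∀ v ∈ B, G.Adj u v → d ≤ ((C.filter fun w => G.Adj u w ∧ G.Adj v w).card : ℝ)

/-- `S` consists of edges of `G` between `A` and `B`. -/
def IsEdgeRel (G : SimpleGraph W) (A B : Finset W) (S : W → W → Prop) : Prop :=
  ∀ u v, S u v → u ∈ A ∧ v ∈ B ∧ G.Adj u v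

lemma IsEdgeRel.next {G : SimpleGraph W} {A B C : Finset W} {S : W → W → Prop}
    (hS : IsEdgeRel G A B S) : IsEdgeRel G B C (nextRel G C S) := by
  rintro v w ⟨hw, hvw, u, hu, _⟩
  exact ⟨(hS u v hu).2.1, hw, hvw⟩

variable [Fintype W]

namespace EdgeBounded

variable {G H : SimpleGraph W} {p D : ℝ}

lemma mono (hH : EdgeBounded H p D) (hGH : G ≤ H) : EdgeBounded G p D := by
  have key : ∀ A B : Finset W,
      ((edgesBetween G A B).card : ℝ) ≤ (edgesBetween H A B).card := fun A B => by
    rw [card_edgesBetween, card_edgesBetween]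
    exact relCard_mono subset_rfl subset_rfl fun u _ v _ h => hGH h
  exact ⟨fun A B h => (key A B).trans (hH.1 A B h), fun v A h => (key _ A).trans (hH.2 v A h)⟩

lemma relCard_le (hG : EdgeBounded G p D) {A B : Finset W} (hAB : Disjoint A B) :
    (relCard G.Adj A B : ℝ) ≤ 2 * p * (A.card * B.card) + D * (A.card + B.card) := by
  rw [← card_edgesBetween]; exact hG.1 A B hAB

lemma card_inN_le (hG : EdgeBounded G p D) {A : Finset W} {v : W} (hv : v ∉ A) :
    ((inN G.Adj A v).card : ℝ) ≤ 2 * p * Fintype.card W + D := by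
  have h := hG.2 v A hv
  rw [card_edgesBetween, relCard_singleton_left] at h
  have : inN G.Adj A v = outN G.Adj A v := by ext; simp [mem_inN, mem_outN, G.adj_comm]
  rwa [this]

end EdgeBounded

section Step

variable {G : SimpleGraph W} {A B C : Finset W} {S : W → W → Prop} {p D d L : ℝ}

/-- Double counting of the edges between the in-neighbours of `v` and the vertices reached through
`v`: all triangle apexes lie in the latter set. -/
lemma mul_card_inN_le (hG : EdgeBounded G p D) (hAC : Disjoint A C)
    (hS : IsEdgeRel G A B S) (ht : ClosesTriangles G A B C d) (v : W) :
    d * (inN S A v).card ≤ 2 * p * ((inN S A v).card * (outN (nextRel G C S) C v).card) +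
      D * ((inN S A v).card + (outN (nextRel G C S) C v).card) := by
  have hdisj : Disjoint (inN S A v) (outN (nextRel G C S) C v) :=
    Finset.disjoint_of_subset_left (Finset.filter_subset _ _)
      (Finset.disjoint_of_subset_right (Finset.filter_subset _ _) hAC)
  refine le_trans ?_ (hG.relCard_le hdisj)
  rw [relCard_eq_sum_out, mul_comm, ← nsmul_eq_mul]
  refine Finset.card_nsmul_le_sum _ _ _ fun u hu => ?_
  rw [mem_inN] at hu
  obtain ⟨huA, hvB, huv⟩ := hS u v hu.2
  refine (ht u huA v hvB huv).trans (Nat.cast_le.2 (Finset.card_le_card fun w hw => ?_))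
  simp only [Finset.mem_filter] at hw
  exact mem_outN.2 ⟨mem_outN.2 ⟨hw.1, hw.1, hw.2.2, u, hu.2, hw.2.1⟩, hw.2.1⟩

/-- Since 2D ≤ d, the term Da is absorbed by half of da; the other two terms are at most 3Lb. -/
lemma card_outN_ge_of_unsaturated (hG : EdgeBounded G p D) (hAC : Disjoint A C)
    (hS : IsEdgeRel G A B S) (ht : ClosesTriangles G A B C d) (hDL : D ≤ L)
    (hL : 0 < L) (hDd : 2 * D ≤ d) {v : W} (hv : p * (inN S A v).card ≤ L) :
    d / (6 * L) * (inN S A v).card ≤ (outN (nextRel G C S) C v).card := by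
  have h := mul_card_inN_le hG hAC hS ht v
  set a : ℝ := ((inN S A v).card : ℝ)
  set b : ℝ := ((outN (nextRel G C S) C v).card : ℝ)
  have ha : 0 ≤ a := Nat.cast_nonneg _
  have hb : 0 ≤ b := Nat.cast_nonneg _
  rw [div_mul_eq_mul_div, div_le_iff₀ (by positivity)]
  have h1 : p * a * b ≤ L * b := mul_le_mul_of_nonneg_right hv hb
  have h2 : D * b ≤ L * b := mul_le_mul_of_nonneg_right hDL hb
  have h3 : 2 * D * a ≤ d * a := mul_le_mul_of_nonneg_right hDd ha
  nlinarith

/-- Here Db is at most pab, so a cancels. The threshold D lies below the threshold L of the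
unsaturated case, and the overlap is what allows vertices of moderate in-degree to be treated as
saturated. -/
lemma card_outN_ge_of_saturated (hG : EdgeBounded G p D) (hAC : Disjoint A C)
    (hS : IsEdgeRel G A B S) (ht : ClosesTriangles G A B C d) (hp : 0 < p) (hD : 0 < D)
    (hDd : 2 * D ≤ d) {v : W} (hv : D ≤ p * (inN S A v).card) :
    d / (6 * p) ≤ (outN (nextRel G C S) C v).card := by
  have h := mul_card_inN_le hG hAC hS ht v
  set a : ℝ := ((inN S A v).card : ℝ)
  set b : ℝ := ((outN (nextRel G C S) C v).card : ℝ)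
  have ha : 0 < a := pos_of_mul_pos_right (hD.trans_le hv) hp.le
  have hb : 0 ≤ b := Nat.cast_nonneg _
  rw [div_le_iff₀ (by positivity)]
  have h2 : D * b ≤ p * a * b := mul_le_mul_of_nonneg_right hv hb
  have h3 : 2 * D * a ≤ d * a := mul_le_mul_of_nonneg_right hDd ha.le
  have h4 : a * d ≤ a * (b * (6 * p)) := by nlinarith
  exact le_of_mul_le_mul_left h4 ha

lemma sum_card_outN_ge_of_unsaturated (hG : EdgeBounded G p D) (hAC : Disjoint A C)
    (hS : IsEdgeRel G A B S) (ht : ClosesTriangles G A B C d) (hDL : D ≤ L)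
    (hL : 0 < L) (hDd : 2 * D ≤ d) {R : Finset W} (hRB : R ⊆ B)
    (hR : ∀ v ∈ R, p * (inN S A v).card ≤ L) :
    d / (6 * L) * ∑ v ∈ R, ((inN S A v).card : ℝ) ≤ relCard (nextRel G C S) B C := by
  rw [relCard_eq_sum_out, Finset.mul_sum]
  refine (Finset.sum_le_sum fun v hv =>
    card_outN_ge_of_unsaturated hG hAC hS ht hDL hL hDd (hR v hv)).trans ?_
  exact Finset.sum_le_sum_of_subset_of_nonneg hRB fun _ _ _ => Nat.cast_nonneg _

/-- Vertices that receive many edges from `T` account for few edges. -/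
lemma sum_card_inN_heavy_le (hG : EdgeBounded G p D) {T : Finset W} (hTC : Disjoint T C)
    (hS : IsEdgeRel G T C S) :
    ∑ w ∈ C.filter (fun w => ¬ ((inN S T w).card : ℝ) ≤ 4 * p * T.card + 2 * D),
      ((inN S T w).card : ℝ) ≤ 2 * D * T.card := by
  set Z := C.filter (fun w => ¬ ((inN S T w).card : ℝ) ≤ 4 * p * T.card + 2 * D)
  have hTZ : Disjoint T Z := Finset.disjoint_of_subset_right (Finset.filter_subset _ _) hTC
  have h1 : ∑ w ∈ Z, ((inN S T w).card : ℝ) ≤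
      2 * p * (T.card * Z.card) + D * (T.card + Z.card) := by
    rw [← relCard_eq_sum_in]
    exact (relCard_mono subset_rfl subset_rfl fun u _ v _ h => (hS u v h).2.2).trans
      (hG.relCard_le hTZ)
  -- With σ the sum and t = |T|, the first bound now reads σ ≤ σ/2 + Dt.
  have h2 : (Z.card : ℝ) * (4 * p * T.card + 2 * D) ≤ ∑ w ∈ Z, ((inN S T w).card : ℝ) := by
    rw [← nsmul_eq_mul]
    refine Finset.card_nsmul_le_sum _ _ _ fun w hw => ?_
    exact (not_le.1 (Finset.mem_filter.1 hw).2).le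
  linarith

end Step

/-! ### Two steps: growth or positive density -/

section TwoSteps

variable {G : SimpleGraph W} {V₀ V₁ V₂ V₃ : Finset W} {S : W → W → Prop} {p D d L b g m : ℝ}

/-- At least `c` vertices of `A` have at least `b` out-neighbours in `B`. -/
def ManyOut (S : W → W → Prop) (A B : Finset W) (c b : ℝ) : Prop :=
  ∃ X ⊆ A, c ≤ (X.card : ℝ) ∧ ∀ x ∈ X, b ≤ ((outN S B x).card : ℝ)

/-- Two steps from a set of pairs: either it grows by a factor `g` in one step or in two, or a
positive proportion of the vertices is reached with positive density. -/
theorem growth_or_manyOut (hG : EdgeBounded G p D)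
    (h01 : Disjoint V₀ V₁) (h02 : Disjoint V₀ V₂) (h12 : Disjoint V₁ V₂) (h13 : Disjoint V₁ V₃)
    (hS : IsEdgeRel G V₀ V₁ S)
    (ht : ClosesTriangles G V₀ V₁ V₂ d) (ht' : ClosesTriangles G V₁ V₂ V₃ d)
    (hp : 0 < p) (hp1 : p ≤ 1) (hD : 0 < D) (hDL : 10 * D ≤ L) (hDd : 2 * D ≤ d)
    (hDN : D ≤ p * Fintype.card W) (hb : 6 * p * b ≤ d) (hDb : 4 * D ≤ b)
    (hm : (V₂.card : ℝ) = m) (hm0 : 0 < m) (hLb : 32 * D * p * m ≤ L * b)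
    (hg₁ : g ≤ d / (12 * L)) (hg₂ : g ≤ d * b / (72 * L * p * Fintype.card W)) :
    ManyOut (nextRel G V₃ (nextRel G V₂ S)) V₂ V₃ (b / (20 * p)) b ∨
    ((relCard S V₀ V₁ : ℝ) ≤ 2 * Fintype.card W * L / p ∧
      (g * relCard S V₀ V₁ ≤ relCard (nextRel G V₂ S) V₁ V₂ ∨
        g * relCard S V₀ V₁ ≤ relCard (nextRel G V₃ (nextRel G V₂ S)) V₂ V₃)) := by
  set N : ℝ := (Fintype.card W : ℝ) with hNdef
  have hL : 0 < L := by linarith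
  have hd : 0 < d := by linarith
  have hb0 : 0 < b := by linarith
  have hN : 0 < N := pos_of_mul_pos_right (hD.trans_le hDN) hp.le
  have hcard : ∀ X : Finset W, (X.card : ℝ) ≤ N := fun X => by
    rw [hNdef]; exact_mod_cast Finset.card_le_univ X
  set R := V₁.filter fun v => p * ((inN S V₀ v).card : ℝ) ≤ L
  set T := V₁.filter fun v => ¬ p * ((inN S V₀ v).card : ℝ) ≤ L with hTdef
  have hsplit : (relCard S V₀ V₁ : ℝ) =
      ∑ v ∈ R, ((inN S V₀ v).card : ℝ) + ∑ v ∈ T, ((inN S V₀ v).card : ℝ) := by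
    rw [relCard_eq_sum_in, Finset.sum_filter_add_sum_filter_not]
  set s : ℝ := (relCard S V₀ V₁ : ℝ)
  have hs0 : 0 ≤ s := Nat.cast_nonneg _
  rcases le_total (s / 2) (∑ v ∈ R, ((inN S V₀ v).card : ℝ)) with hcase | hcase
  · refine Or.inr ⟨?_, Or.inl ?_⟩
    · have h1 : ∑ v ∈ R, ((inN S V₀ v).card : ℝ) ≤ R.card * (L / p) := by
        rw [← nsmul_eq_mul]
        refine Finset.sum_le_card_nsmul _ _ _ fun v hv => ?_
        rw [le_div_iff₀ hp, mul_comm]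
        exact (Finset.mem_filter.1 hv).2
      have h2 : (R.card : ℝ) * (L / p) ≤ N * (L / p) :=
        mul_le_mul_of_nonneg_right (hcard R) (by positivity)
      have h3 : 2 * N * L / p = 2 * (N * (L / p)) := by ring
      rw [h3]; linarith
    · have h1 := sum_card_outN_ge_of_unsaturated (L := L) hG h02 hS ht (by linarith) hL hDd
        (R := R) (Finset.filter_subset _ _) fun v hv => (Finset.mem_filter.1 hv).2
      refine le_trans ?_ h1
      have h2 : d / (6 * L) * (s / 2) = d / (12 * L) * s := by ring
      calc g * s ≤ d / (12 * L) * s := mul_le_mul_of_nonneg_right hg₁ hs0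
        _ = d / (6 * L) * (s / 2) := h2.symm
        _ ≤ _ := mul_le_mul_of_nonneg_left hcase (by positivity)
  -- Most pairs of `S` end in a vertex of `T`.
  have hTs : s / 2 ≤ ∑ v ∈ T, ((inN S V₀ v).card : ℝ) := by linarith
  have hTV : T ⊆ V₁ := Finset.filter_subset _ _
  set t : ℝ := (T.card : ℝ) with htdef
  have ht0 : 0 ≤ t := Nat.cast_nonneg _
  -- In-degrees are at most 2pN + D ≤ 3pN, and `T` receives at least half of the pairs.
  have hts : s ≤ 6 * p * N * t := by
    have h1 : ∑ v ∈ T, ((inN S V₀ v).card : ℝ) ≤ T.card * (3 * p * N) := by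
      rw [← nsmul_eq_mul]
      refine Finset.sum_le_card_nsmul _ _ _ fun v hv => ?_
      have h2 : v ∉ V₀ := Finset.disjoint_right.1 h01 (hTV hv)
      have h3 : ((inN S V₀ v).card : ℝ) ≤ (inN G.Adj V₀ v).card := by
        refine Nat.cast_le.2 (Finset.card_le_card fun u hu => ?_)
        rw [mem_inN] at hu ⊢
        exact ⟨hu.1, (hS u v hu.2).2.2⟩
      have h4 := hG.card_inN_le h2
      linarith
    nlinarith
  let S' : W → W → Prop := fun v w => v ∈ T ∧ nextRel G V₂ S v w
  have hS'T : IsEdgeRel G T V₂ S' := fun v w h => ⟨h.1, (hS.next v w h.2).2⟩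
  have hS'1 : IsEdgeRel G V₁ V₂ S' := fun v w h => hS.next v w h.2
  have hin : ∀ w, inN S' V₁ w = inN S' T w := by
    intro w; ext v
    simp only [mem_inN]
    exact ⟨fun h => ⟨h.2.1, h.2⟩, fun h => ⟨hTV h.1, h.2⟩⟩
  have hout : t * b ≤ ∑ w ∈ V₂, ((inN S' T w).card : ℝ) := by
    rw [← relCard_eq_sum_in, relCard_eq_sum_out, htdef, ← nsmul_eq_mul]
    refine Finset.card_nsmul_le_sum _ _ _ fun v hv => ?_
    have h1 : outN S' V₂ v = outN (nextRel G V₂ S) V₂ v := by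
      ext w; simp [mem_outN, S', hv]
    rw [h1]
    have h2 := not_le.1 (Finset.mem_filter.1 hv).2
    have h3 := card_outN_ge_of_saturated hG h02 hS ht hp hD hDd (v := v) (by linarith)
    refine le_trans ?_ h3
    rw [le_div_iff₀ (by positivity)]; linarith
  -- Discarding the heavy vertices costs at most 2Dt pairs, which is at most half of tb because 4D ≤
  -- b.
  set Y := V₂.filter fun w => ((inN S' T w).card : ℝ) ≤ 4 * p * t + 2 * D
  have hYsum : t * b / 2 ≤ ∑ w ∈ Y, ((inN S' T w).card : ℝ) := by
    have h1 := sum_card_inN_heavy_le hG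
      (Finset.disjoint_of_subset_left hTV h12) hS'T
    have h2 := Finset.sum_filter_add_sum_filter_not V₂
      (fun w => ((inN S' T w).card : ℝ) ≤ 4 * p * t + 2 * D) (fun w => ((inN S' T w).card : ℝ))
    nlinarith
  have hYV : Y ⊆ V₂ := Finset.filter_subset _ _
  -- Either all of `Y` is unsaturated, and the second step makes up for the loss in the first, or
  -- `T` is so large that a typical vertex of `Y` is saturated.
  rcases le_or_gt (p * (4 * p * t + 2 * D)) L with hsmall | hlarge
  · refine Or.inr ⟨?_, Or.inr ?_⟩
    · rw [le_div_iff₀ hp]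
      have h1 : p * (4 * p * t) ≤ L := by nlinarith
      nlinarith
    · have h1 := sum_card_outN_ge_of_unsaturated (L := L) hG h13 hS'1 ht' (by linarith) hL hDd
        hYV fun w hw => by
          rw [hin]
          exact (mul_le_mul_of_nonneg_left (Finset.mem_filter.1 hw).2 hp.le).trans hsmall
      simp only [hin] at h1
      have h2 : (relCard (nextRel G V₃ S') V₂ V₃ : ℝ) ≤
          relCard (nextRel G V₃ (nextRel G V₂ S)) V₂ V₃ :=
        relCard_mono subset_rfl subset_rfl fun u _ v _ h =>
          nextRel_mono (fun x y hxy => hxy.2) h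
      refine le_trans ?_ (h1.trans h2)
      calc g * s ≤ d * b / (72 * L * p * N) * (6 * p * N * t) :=
            mul_le_mul hg₂ hts hs0 (by positivity)
        _ = d / (6 * L) * (t * b / 2) := by field_simp; ring
        _ ≤ _ := mul_le_mul_of_nonneg_left hYsum (by positivity)
  · left
    have hpt : L ≤ 8 * p * (p * t) := by nlinarith
    have ht1 : 0 < t := by
      by_contra h
      have : t = 0 := le_antisymm (not_lt.1 h) ht0
      rw [this] at hpt; linarith
    have hDt : 2 * D ≤ p * t := by
      have : p * (p * t) ≤ p * t := mul_le_of_le_one_left (by positivity) hp1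
      nlinarith
    -- Vertices below a quarter of the average tb/m carry at most tb/4 pairs. The remaining tb/4
    -- pairs, with in-degrees at most 5pt, force |X| ≥ b/(20p).
    set X := Y.filter fun w => ¬ ((inN S' T w).card : ℝ) ≤ t * b / (4 * m)
    have hXsum : t * b / 4 ≤ ∑ w ∈ X, ((inN S' T w).card : ℝ) := by
      have h2 := Finset.sum_filter_add_sum_filter_not Y
        (fun w => ((inN S' T w).card : ℝ) ≤ t * b / (4 * m)) (fun w => ((inN S' T w).card : ℝ))
      have h3 : ∑ w ∈ Y.filter (fun w => ((inN S' T w).card : ℝ) ≤ t * b / (4 * m)),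
          ((inN S' T w).card : ℝ) ≤ m * (t * b / (4 * m)) := by
        refine (Finset.sum_le_card_nsmul _ _ (t * b / (4 * m))
          fun w hw => (Finset.mem_filter.1 hw).2).trans ?_
        rw [nsmul_eq_mul, ← hm]
        refine mul_le_mul_of_nonneg_right ?_ (by positivity)
        exact Nat.cast_le.2 (Finset.card_le_card ((Finset.filter_subset _ _).trans hYV))
      have h4 : m * (t * b / (4 * m)) = t * b / 4 := by field_simp
      linarith
    refine ⟨X, (Finset.filter_subset _ _).trans hYV, ?_, fun w hw => ?_⟩
    · have h1 : ∑ w ∈ X, ((inN S' T w).card : ℝ) ≤ X.card * (5 * (p * t)) := by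
        rw [← nsmul_eq_mul]
        refine Finset.sum_le_card_nsmul _ _ _ fun w hw => ?_
        have := (Finset.mem_filter.1 (Finset.mem_filter.1 hw).1).2
        linarith
      rw [div_le_iff₀ (by positivity)]
      have h2 : t * b ≤ t * (X.card * (20 * p)) := by nlinarith
      exact le_of_mul_le_mul_left h2 ht1
    · have h1 : D ≤ p * (inN S' V₁ w).card := by
        rw [hin]
        have h2 := not_le.1 (Finset.mem_filter.1 hw).2
        have h3 : D ≤ p * (t * b / (4 * m)) := by
          rw [mul_div_assoc', le_div_iff₀ (by positivity)]
          have h4 : p * (32 * D * m) ≤ p * (8 * (p * t) * b) := by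
            have h6 := hLb.trans (mul_le_mul_of_nonneg_right hpt hb0.le)
            linarith
          have h5 := le_of_mul_le_mul_left h4 hp
          linarith
        exact h3.trans (mul_le_mul_of_nonneg_left h2.le hp.le)
      have h2 := card_outN_ge_of_saturated hG h13 hS'1 ht' hp hD hDd h1
      have h3 : ((outN (nextRel G V₃ S') V₃ w).card : ℝ) ≤
          (outN (nextRel G V₃ (nextRel G V₂ S)) V₃ w).card := by
        refine Nat.cast_le.2 (Finset.card_le_card fun x hx => ?_)
        rw [mem_outN] at hx ⊢
        exact ⟨hx.1, nextRel_mono (fun x y hxy => hxy.2) hx.2⟩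
      refine le_trans ?_ (h2.trans h3)
      rw [le_div_iff₀ (by positivity)]; linarith

end TwoSteps

end PathExpansion

namespace PathExpansion

open scoped Classical

variable {W : Type*}

/-! ### Spreading by regularity -/

lemma nbhdIn_eq_outN (G : SimpleGraph W) (v : W) (A : Finset W) :
    nbhdIn G v A = outN G.Adj A v := rfl

lemma relCard_adj_eq_density (G : SimpleGraph W) (A B : Finset W) :
    (relCard G.Adj A B : ℝ) = density G A B * (A.card * B.card) := by
  rw [density, card_edgesBetween]
  by_cases h : (A.card : ℝ) * B.card = 0
  · have h0 : relCard G.Adj A B = 0 := by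
      have h1 : A.card * B.card = 0 := by exact_mod_cast h
      have h2 : relCard G.Adj A B ≤ A.card * B.card := by
        rw [← Finset.card_product]; exact Finset.card_filter_le _ _
      omega
    rw [h, h0]; simp
  · rw [div_mul_cancel₀ _ h]

/-- Edge counts between large subsets of `A` and `B` are within a factor two of what the
density `q` predicts. -/
def IsBalanced (G : SimpleGraph W) (A B : Finset W) (q r : ℝ) : Prop :=
  ∀ X ⊆ A, ∀ Y ⊆ B, r ≤ (X.card : ℝ) → r ≤ (Y.card : ℝ) →
    q / 2 * (X.card * Y.card) ≤ relCard G.Adj X Y ∧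
      (relCard G.Adj X Y : ℝ) ≤ 2 * q * (X.card * Y.card)

variable {G : SimpleGraph W} {A B C : Finset W} {S : W → W → Prop} {q ε m c : ℝ}

lemma IsRegular.isBalanced (hreg : IsRegular G ε A B) (hq : 0 ≤ q)
    (hε' : ε ≤ 1 / 100) (hA : (A.card : ℝ) = m) (hB : (B.card : ℝ) = m)
    (hl : (1 - ε) * q ≤ density G A B) (hu : density G A B ≤ (1 + ε) * q) :
    IsBalanced G A B q (ε * m) := by
  intro X hX Y hY hXc hYc
  have h := abs_le.1 (hreg X hX Y hY (by rwa [hA]) (by rwa [hB]))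
  rw [relCard_adj_eq_density]
  have hd : 0 ≤ density G A B := by rw [density]; positivity
  have h1 : ε * density G A B ≤ 1 / 100 * density G A B := mul_le_mul_of_nonneg_right hε' hd
  have h2 : ε * q ≤ 1 / 100 * q := mul_le_mul_of_nonneg_right hε' hq
  constructor <;> refine mul_le_mul_of_nonneg_right ?_ (by positivity) <;> linarith [h.1, h.2]

/-- The neighbours of `v` in `C` that are not reached send no edge to the vertices from which `v` is
reached. Lower-regularity therefore makes them fewer than an ε-fraction. -/
lemma card_outN_next_ge (hS : IsEdgeRel G A B S) (hq : 0 < q) (hε₀ : 0 ≤ ε) (hε : ε < 1) {v : W}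
    (hv : IsLowerRegular G ε q (nbhdIn G v A) (nbhdIn G v C)) (hne : (inN S A v).Nonempty)
    (hin : ε * (inN G.Adj A v).card ≤ (inN S A v).card) :
    (1 - ε) * (outN G.Adj C v).card ≤ (outN (nextRel G C S) C v).card := by
  set Z := outN G.Adj C v \ outN (nextRel G C S) C v
  have hsub : outN (nextRel G C S) C v ⊆ outN G.Adj C v := fun w hw => by
    rw [mem_outN] at hw ⊢; exact ⟨hw.1, hw.2.2.1⟩
  have hcard : ((outN G.Adj C v).card : ℝ) = Z.card + (outN (nextRel G C S) C v).card := by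
    exact_mod_cast (Finset.card_sdiff_add_card_eq_card hsub).symm
  have hZ : (Z.card : ℝ) ≤ ε * (outN G.Adj C v).card := by
    by_contra hcon
    rw [not_le] at hcon
    have hεZ : Z.Nonempty := by
      rw [Finset.nonempty_iff_ne_empty]
      intro h0
      rw [h0, Finset.card_empty, Nat.cast_zero] at hcon
      exact absurd hcon (not_lt.2 (by positivity))
    have hNA : nbhdIn G v A = inN G.Adj A v := by
      ext; simp [nbhdIn_eq_outN, mem_outN, mem_inN, G.adj_comm]
    have h1 := hv (inN S A v) (fun u hu => by
        rw [mem_inN] at hu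
        rw [hNA, mem_inN]; exact ⟨hu.1, (hS u v hu.2).2.2⟩) Z Finset.sdiff_subset hne hεZ
      (by rwa [hNA]) (by rw [nbhdIn_eq_outN]; exact hcon.le)
    have h2 : edgesBetween G (inN S A v) Z = ∅ := by
      ext e
      simp only [mem_edgesBetween, Finset.notMem_empty, iff_false, not_and]
      intro he1 he2 hadj
      rw [Finset.mem_sdiff, mem_outN, mem_outN] at he2
      rw [mem_inN] at he1
      exact he2.2 ⟨he2.1.1, he2.1.1, he2.1.2, e.1, he1.2, hadj⟩
    rw [density, h2] at h1
    simp only [Finset.card_empty, Nat.cast_zero, zero_div] at h1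
    nlinarith
  linarith

lemma card_high_le (hbal : IsBalanced G A B q (ε * m)) (hA : (A.card : ℝ) = m)
    (hm : 0 < m) (hε : 0 < ε) (hε' : ε ≤ 1) :
    ((B.filter fun v => 2 * q * m < (inN G.Adj A v).card).card : ℝ) ≤ ε * m := by
  by_contra hcon
  rw [not_le] at hcon
  set Y := B.filter fun v => 2 * q * m < ((inN G.Adj A v).card : ℝ)
  have h1 := (hbal A subset_rfl Y (Finset.filter_subset _ _) (by rw [hA]; nlinarith) hcon.le).2
  have hYne : Y.Nonempty := by
    rw [← Finset.card_pos]
    have : 0 < ε * m := by positivity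
    exact_mod_cast this.trans hcon
  have h2 : ∑ _v ∈ Y, 2 * q * m < ∑ v ∈ Y, ((inN G.Adj A v).card : ℝ) :=
    Finset.sum_lt_sum_of_nonempty hYne fun v hv => (Finset.mem_filter.1 hv).2
  rw [relCard_eq_sum_in, hA] at h1
  rw [Finset.sum_const, nsmul_eq_mul] at h2
  linarith

/-- At least `c` vertices of `A` are related to almost all of their neighbours in `B`. -/
def NearlyFull (G : SimpleGraph W) (S : W → W → Prop) (A B : Finset W) (c ε : ℝ) : Prop :=
  ∃ X ⊆ A, c ≤ (X.card : ℝ) ∧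
    ∀ x ∈ X, (1 - ε) * (outN G.Adj B x).card ≤ ((outN S B x).card : ℝ)

/-- The edges of three consecutive vertex sets of a regular blow-up of the square of a path, as
far as they matter for spreading from `E(A, B)` to `E(B, C)`. -/
structure SpreadTriple (G : SimpleGraph W) (A B C : Finset W) (q ε m : ℝ) : Prop where
  balanced : IsBalanced G A B q (ε * m)
  card_left : (A.card : ℝ) = m
  card_mid : (B.card : ℝ) = m
  lowerRegular : ((B.filter fun v =>
    ¬ IsLowerRegular G ε q (nbhdIn G v A) (nbhdIn G v C)).card : ℝ) ≤ ε * m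
  m_pos : 0 < m
  q_pos : 0 < q
  ε_pos : 0 < ε
  ε_le : ε ≤ 1 / 100

/-- Two exceptional sets of size at most εm are removed: vertices violating lower-regularity, and
those with more than 2qm neighbours in `A`. For the others 2εqm is at least an ε-fraction of the
backward neighbourhood. -/
lemma SpreadTriple.nearlyFull_next (h : SpreadTriple G A B C q ε m) (hS : IsEdgeRel G A B S)
    {Y : Finset W} (hY : Y ⊆ B) (hin : ∀ y ∈ Y, 2 * ε * q * m ≤ (inN S A y).card) :
    NearlyFull G (nextRel G C S) B C (Y.card - 2 * ε * m) ε := by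
  have hε := h.ε_le
  have hε0 := h.ε_pos
  have hq := h.q_pos
  have hm := h.m_pos
  set Z₁ := B.filter fun v => ¬ IsLowerRegular G ε q (nbhdIn G v A) (nbhdIn G v C) with hZ₁def
  set Z₂ := B.filter fun v => 2 * q * m < ((inN G.Adj A v).card : ℝ) with hZ₂def
  have hZ₁ : (Z₁.card : ℝ) ≤ ε * m := h.lowerRegular
  have hZ₂ : (Z₂.card : ℝ) ≤ ε * m := card_high_le h.balanced h.card_left hm hε0 (by linarith)
  refine ⟨(Y \ Z₁) \ Z₂, (Finset.sdiff_subset.trans Finset.sdiff_subset).trans hY, ?_, ?_⟩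
  · have h1 : (Y.card : ℝ) - Z₁.card ≤ (Y \ Z₁).card := by
      have := Finset.le_card_sdiff Z₁ Y
      rw [sub_le_iff_le_add]; exact_mod_cast Nat.sub_le_iff_le_add.1 this
    have h2 : ((Y \ Z₁).card : ℝ) - Z₂.card ≤ ((Y \ Z₁) \ Z₂).card := by
      have := Finset.le_card_sdiff Z₂ (Y \ Z₁)
      rw [sub_le_iff_le_add]; exact_mod_cast Nat.sub_le_iff_le_add.1 this
    linarith
  · intro y hy
    simp only [Finset.mem_sdiff] at hy
    obtain ⟨⟨hyY, hy1⟩, hy2⟩ := hy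
    have hlow : IsLowerRegular G ε q (nbhdIn G y A) (nbhdIn G y C) := by
      by_contra hcon
      exact hy1 (Finset.mem_filter.2 ⟨hY hyY, hcon⟩)
    have hdeg : ((inN G.Adj A y).card : ℝ) ≤ 2 * q * m := by
      by_contra hcon
      exact hy2 (Finset.mem_filter.2 ⟨hY hyY, not_le.1 hcon⟩)
    have h3 := hin y hyY
    refine card_outN_next_ge hS hq hε0.le (by linarith) hlow ?_ ?_
    · rw [← Finset.card_pos]
      have : 0 < 2 * ε * q * m := by positivity
      exact_mod_cast this.trans_le h3
    · nlinarith

/-- There are at least c₁c₂qm² pairs, and half of them end in vertices of in-degree above c₁c₂qm/2.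
The upper bound on edge counts spreads that half over at least c₁c₂m/4 vertices, of which 2εm may be
exceptional. -/
lemma SpreadTriple.nearlyFull_of_manyOut (h : SpreadTriple G A B C q ε m)
    (hS : IsEdgeRel G A B S) {c₁ c₂ : ℝ} (hc₁ : 0 ≤ c₁) (hF : ManyOut S A B (c₂ * m) (c₁ * q * m))
    (hε : 16 * ε ≤ c₁ * c₂) (hm : 1 ≤ ε * m) :
    NearlyFull G (nextRel G C S) B C (c₁ * c₂ / 8 * m) ε := by
  have hε1 := h.ε_le
  have hε0 := h.ε_pos
  have hq := h.q_pos
  have hm0 := h.m_pos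
  obtain ⟨X, hXA, hX, hout⟩ := hF
  set c₃ := c₁ * c₂ / 2 with hc₃
  have htotal : 2 * c₃ * q * m ^ 2 ≤ relCard S A B := by
    have h1 : (X.card : ℝ) * (c₁ * q * m) ≤ relCard S A B := by
      refine le_trans ?_ (relCard_mono hXA subset_rfl fun _ _ _ _ h => h)
      rw [relCard_eq_sum_out, ← nsmul_eq_mul]
      exact Finset.card_nsmul_le_sum _ _ _ hout
    have h2 : c₂ * m * (c₁ * q * m) ≤ X.card * (c₁ * q * m) :=
      mul_le_mul_of_nonneg_right hX (by positivity)
    nlinarith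
  set Y := B.filter fun v => ¬ ((inN S A v).card : ℝ) ≤ c₃ * q * m
  have hYB : Y ⊆ B := Finset.filter_subset _ _
  have hYsum : c₃ * q * m ^ 2 ≤ ∑ v ∈ Y, ((inN S A v).card : ℝ) := by
    rw [relCard_eq_sum_in, ← Finset.sum_filter_add_sum_filter_not B
      (fun v => ((inN S A v).card : ℝ) ≤ c₃ * q * m)] at htotal
    have h1 : ∑ v ∈ B.filter (fun v => ((inN S A v).card : ℝ) ≤ c₃ * q * m),
        ((inN S A v).card : ℝ) ≤ m * (c₃ * q * m) := by
      refine (Finset.sum_le_card_nsmul _ _ _ fun v hv => (Finset.mem_filter.1 hv).2).trans ?_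
      rw [nsmul_eq_mul, ← h.card_mid]
      refine mul_le_mul_of_nonneg_right (Nat.cast_le.2 (Finset.card_filter_le _ _)) ?_
      have : 0 ≤ c₃ := by linarith
      rw [h.card_mid]; positivity
    linarith
  have hYadj : ∀ Y' : Finset W, Y ⊆ Y' →
      ∑ v ∈ Y, ((inN S A v).card : ℝ) ≤ relCard G.Adj A Y' := fun Y' hY' => by
    rw [← relCard_eq_sum_in]
    exact relCard_mono subset_rfl hY' fun u _ v _ huv => (hS u v huv).2.2
  have hAm : ε * m ≤ (A.card : ℝ) := by rw [h.card_left]; nlinarith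
  have hYcard : c₃ / 2 * m ≤ Y.card := by
    rcases le_or_gt (ε * m) Y.card with hbig | hsmall
    · have h1 := (h.balanced A subset_rfl Y hYB hAm hbig).2
      have h2 := hYsum.trans ((hYadj Y subset_rfl).trans h1)
      rw [h.card_left] at h2
      have h3 : (2 * q * m) * (c₃ / 2 * m) ≤ (2 * q * m) * Y.card := by linarith
      exact le_of_mul_le_mul_left h3 (by positivity)
    -- A set below the regularity threshold is enlarged to ⌈εm⌉ ≤ 2εm vertices, still too few to
    -- hold so many edges.
    · exfalso
      have h0 : Y.card ≤ ⌈ε * m⌉₊ := by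
        have := hsmall.trans_le (Nat.le_ceil (ε * m)); exact_mod_cast this.le
      have h0' : ⌈ε * m⌉₊ ≤ B.card := by
        rw [Nat.ceil_le, h.card_mid]; nlinarith
      obtain ⟨Y', hYY', hY'B, hY'⟩ := Finset.exists_subsuperset_card_eq hYB h0 h0'
      have h1 := (h.balanced A subset_rfl Y' hY'B hAm (by rw [hY']; exact Nat.le_ceil _)).2
      have h2 := hYsum.trans ((hYadj Y' hYY').trans h1)
      have h4 : (Y'.card : ℝ) < ε * m + 1 := by
        rw [hY']; exact Nat.ceil_lt_add_one (by positivity)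
      rw [h.card_left] at h2
      have h5 : (2 * q * m) * (c₃ / 2 * m) ≤ (2 * q * m) * Y'.card := by linarith
      have h6 := le_of_mul_le_mul_left h5 (by positivity)
      nlinarith
  obtain ⟨X', hX', hcard, hfull⟩ := h.nearlyFull_next hS hYB fun y hy => by
    have h1 := not_le.1 (Finset.mem_filter.1 hy).2
    have h2 : 2 * ε * (q * m) ≤ c₃ * (q * m) :=
      mul_le_mul_of_nonneg_right (by linarith) (by positivity)
    linarith
  refine ⟨X', hX', le_trans ?_ hcard, hfull⟩
  nlinarith

/-- Few edges from `X` are missing from `S`, whereas each vertex of in-degree below |X|q/4 misses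
about half of what regularity provides. So at most 8εm vertices are poor, and 2εm more are
exceptional. -/
lemma SpreadTriple.nearlyFull_of_nearlyFull (h : SpreadTriple G A B C q ε m)
    (hS : IsEdgeRel G A B S) (hF : NearlyFull G S A B (c * m) ε) (hc : 8 * ε ≤ c) :
    NearlyFull G (nextRel G C S) B C ((1 - 10 * ε) * m) ε := by
  have hε1 := h.ε_le
  have hε0 := h.ε_pos
  have hq := h.q_pos
  have hm0 := h.m_pos
  obtain ⟨X, hXA, hX, hout⟩ := hF
  have hXm : 8 * ε * m ≤ X.card := le_trans (mul_le_mul_of_nonneg_right hc hm0.le) hX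
  have hXε : ε * m ≤ X.card := by nlinarith
  have hX0 : (0 : ℝ) < X.card := lt_of_lt_of_le (by positivity) hXε
  have hBm : ε * m ≤ (B.card : ℝ) := by rw [h.card_mid]; nlinarith
  let M : W → W → Prop := fun u v => G.Adj u v ∧ ¬ S u v
  have hM : (relCard M X B : ℝ) ≤ 2 * ε * q * X.card * m := by
    have h1 : (relCard M X B : ℝ) ≤ ε * relCard G.Adj X B := by
      rw [relCard_eq_sum_out, relCard_eq_sum_out, Finset.mul_sum]
      refine Finset.sum_le_sum fun x hx => ?_
      have h2 : ((outN M B x).card : ℝ) + (outN S B x).card = (outN G.Adj B x).card := by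
        have h3 : outN M B x ∪ outN S B x = outN G.Adj B x := by
          ext w
          simp only [Finset.mem_union, mem_outN, M]
          constructor
          · rintro (hw | hw)
            · exact ⟨hw.1, hw.2.1⟩
            · exact ⟨hw.1, (hS x w hw.2).2.2⟩
          · rintro ⟨hw, hxw⟩
            by_cases hs : S x w
            · exact Or.inr ⟨hw, hs⟩
            · exact Or.inl ⟨hw, hxw, hs⟩
        have h4 : Disjoint (outN M B x) (outN S B x) := by
          rw [Finset.disjoint_left]
          intro w hw hw'
          exact (mem_outN.1 hw).2.2 (mem_outN.1 hw').2
        rw [← h3, Finset.card_union_of_disjoint h4]; push_cast; rfl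
      have h5 := hout x hx
      linarith
    have h2 := (h.balanced X hXA B subset_rfl hXε hBm).2
    rw [h.card_mid] at h2
    nlinarith
  set Z := B.filter fun y => ((inN S A y).card : ℝ) < X.card * q / 4 with hZdef
  have hZB : Z ⊆ B := Finset.filter_subset _ _
  have hZcard : (Z.card : ℝ) ≤ 8 * ε * m := by
    rcases le_or_gt (ε * m) Z.card with hbig | hsmall
    · have h1 := (h.balanced X hXA Z hZB hXε hbig).1
      have h2 : (relCard G.Adj X Z : ℝ) ≤ relCard M X Z + relCard S X Z := by
        rw [relCard, relCard, relCard]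
        norm_cast
        refine le_trans (Finset.card_le_card fun e he => ?_) (Finset.card_union_le _ _)
        simp only [Finset.mem_filter, Finset.mem_union, M] at he ⊢
        tauto
      have h3 : (relCard M X Z : ℝ) ≤ relCard M X B :=
        relCard_mono subset_rfl hZB fun _ _ _ _ h => h
      have h4 : (relCard S X Z : ℝ) ≤ Z.card * (X.card * q / 4) := by
        rw [relCard_eq_sum_in, ← nsmul_eq_mul]
        refine Finset.sum_le_card_nsmul _ _ _ fun y hy => ?_
        refine le_trans (Nat.cast_le.2 (Finset.card_le_card fun u hu => ?_))
          (Finset.mem_filter.1 hy).2.le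
        rw [mem_inN] at hu ⊢
        exact ⟨hXA hu.1, hu.2⟩
      have h5 : (q * X.card / 4) * Z.card ≤ (q * X.card / 4) * (8 * ε * m) := by linarith
      exact le_of_mul_le_mul_left h5 (by positivity)
    · nlinarith
  obtain ⟨X', hX', hcard, hfull⟩ := h.nearlyFull_next hS (Y := B \ Z) Finset.sdiff_subset
    fun y hy => by
      rw [Finset.mem_sdiff] at hy
      have h1 : X.card * q / 4 ≤ ((inN S A y).card : ℝ) := by
        by_contra hcon
        exact hy.2 (Finset.mem_filter.2 ⟨hy.1, not_le.1 hcon⟩)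
      nlinarith
  refine ⟨X', hX', le_trans ?_ hcard, hfull⟩
  have h1 : ((B \ Z).card : ℝ) = m - Z.card := by
    rw [eq_sub_iff_add_eq, ← h.card_mid]
    exact_mod_cast Finset.card_sdiff_add_card_eq_card hZB
  rw [h1]; linarith

/-- Losses in the number of vertices, in their density and in their out-degrees leave a factor of at
least 0.9 · 0.99 · 0.99. -/
lemma NearlyFull.relCard_ge (hF : NearlyFull G S A B ((1 - 10 * ε) * m) ε)
    (hreg : IsRegular G ε A B) (hA : (A.card : ℝ) = m) (hB : (B.card : ℝ) = m) (hm : 0 ≤ m)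
    (hε : 0 ≤ ε) (hε' : ε ≤ 1 / 100) :
    0.52 * (relCard G.Adj A B : ℝ) ≤ relCard S A B := by
  obtain ⟨X, hXA, hX, hout⟩ := hF
  have h1 : (1 - ε) * relCard G.Adj X B ≤ relCard S A B := by
    refine le_trans ?_ (relCard_mono hXA subset_rfl fun _ _ _ _ h => h)
    rw [relCard_eq_sum_out, relCard_eq_sum_out, Finset.mul_sum]
    exact Finset.sum_le_sum hout
  have hd : 0 ≤ density G A B := by rw [density]; positivity
  have h2 := (abs_le.1 (hreg X hXA B subset_rfl (by rw [hA]; nlinarith) (by nlinarith))).1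
  have hXm : 9 / 10 * m ≤ X.card := by nlinarith
  rw [relCard_adj_eq_density] at h1 ⊢
  rw [hA, hB]
  rw [hB] at h1
  set δ := density G A B
  have h3 : 99 / 100 * δ ≤ density G X B := by nlinarith
  calc 0.52 * (δ * (m * m)) ≤ (1 - ε) * (99 / 100 * δ * (9 / 10 * m * m)) := by
        have : 0 ≤ δ * (m * m) := by positivity
        nlinarith
    _ ≤ (1 - ε) * (density G X B * (X.card * m)) := by
        refine mul_le_mul_of_nonneg_left ?_ (by linarith)
        refine mul_le_mul h3 (mul_le_mul_of_nonneg_right hXm hm) (by positivity) ?_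
        exact le_trans (by positivity) h3
    _ ≤ _ := h1

end PathExpansion

namespace PathExpansion

open scoped Classical

/-! ### The edges reached from a given edge -/

section Reach

variable {W : Type*}

/-- The edges between `V j` and `V (j + 1)` that end the square of a path starting with `e`. -/
def reach (G : SimpleGraph W) (V : ℕ → Finset W) (e : W × W) : ℕ → W → W → Prop
  | 0 => fun u v => (u, v) = e
  | j + 1 => nextRel G (V (j + 2)) (reach G V e j)

variable {G : SimpleGraph W} {V : ℕ → Finset W} {e : W × W}

lemma isEdgeRel_reach (he : e ∈ edgesBetween G (V 0) (V 1)) (j : ℕ) :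
    IsEdgeRel G (V j) (V (j + 1)) (reach G V e j) := by
  induction j with
  | zero => rintro u v rfl; exact mem_edgesBetween.1 he
  | succ j ih => exact ih.next

lemma exists_path_of_reach (he : e ∈ edgesBetween G (V 0) (V 1)) (j : ℕ) {u v : W}
    (h : reach G V e j u v) :
    ∃ f : ℕ → W, f 0 = e.1 ∧ f 1 = e.2 ∧ f j = u ∧ f (j + 1) = v ∧ (∀ i ≤ j + 1, f i ∈ V i) ∧
      ∀ i i', i < i' → i' ≤ i + 2 → i' ≤ j + 1 → G.Adj (f i) (f i') := by
  induction j generalizing u v with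
  | zero =>
    have he' := mem_edgesBetween.1 he
    obtain rfl : (u, v) = e := h
    refine ⟨fun i => if i = 0 then u else v, by simp, by simp, by simp, by simp, ?_, ?_⟩
    · intro i hi
      interval_cases i
      · simpa using he'.1
      · simpa using he'.2.1
    · intro i i' h1 _ h3
      obtain rfl : i = 0 := by omega
      obtain rfl : i' = 1 := by omega
      simpa using he'.2.2
  | succ j ih =>
    obtain ⟨hv, huv, x, hx, hxv⟩ := h
    obtain ⟨f, h0, h1, hj, hj', hV, hadj⟩ := ih hx
    have hne : ∀ i ≤ j + 1, Function.update f (j + 2) v i = f i := fun i hi =>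
      Function.update_of_ne (by omega) _ _
    refine ⟨Function.update f (j + 2) v, ?_, ?_, ?_, ?_, ?_, ?_⟩
    · rw [hne 0 (by omega), h0]
    · rw [hne 1 (by omega), h1]
    · rw [hne (j + 1) le_rfl, hj']
    · exact Function.update_self _ _ _
    · intro i hi
      rcases Nat.lt_or_ge i (j + 2) with h | h
      · rw [hne i (by omega)]; exact hV i (by omega)
      · obtain rfl : i = j + 2 := by omega
        rw [Function.update_self]; exact hv
    · intro i i' hii' hii'2 hi'
      rcases Nat.lt_or_ge i' (j + 2) with h | h
      · rw [hne i (by omega), hne i' (by omega)]; exact hadj i i' hii' hii'2 (by omega)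
      · obtain rfl : i' = j + 2 := by omega
        rw [Function.update_self, hne i (by omega)]
        rcases (by omega : i = j ∨ i = j + 1) with rfl | rfl
        · rw [hj]; exact hxv
        · rw [hj']; exact huv

/-- Once a positive proportion is reached, two steps suffice to reach almost all edges. -/
theorem nearlyFull_reach (he : e ∈ edgesBetween G (V 0) (V 1)) {k : ℕ} {q ε m c₁ c₂ : ℝ}
    (hT : ∀ i, i + 2 ≤ k + 4 → SpreadTriple G (V i) (V (i + 1)) (V (i + 2)) q ε m)
    (hc₁ : 0 ≤ c₁) (hε : 64 * ε ≤ c₁ * c₂) (hm : 1 ≤ ε * m) {j : ℕ} (hj : j ≤ k + 1)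
    (hF : ManyOut (reach G V e j) (V j) (V (j + 1)) (c₂ * m) (c₁ * q * m)) :
    NearlyFull G (reach G V e (k + 3)) (V (k + 3)) (V (k + 4)) ((1 - 10 * ε) * m) ε := by
  have hε0 := (hT 0 (by omega)).ε_pos
  have hε1 := (hT 0 (by omega)).ε_le
  have h1 := (hT j (by omega)).nearlyFull_of_manyOut (isEdgeRel_reach he j) hc₁ hF
    (by linarith) hm
  -- The second step reaches the fraction 1 - 10ε, which later steps reproduce; j ≤ k+1 leaves room
  -- for both.
  have h2 : ∀ l, j + 2 + l ≤ k + 3 → NearlyFull G (reach G V e (j + 2 + l)) (V (j + 2 + l))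
      (V (j + 2 + l + 1)) ((1 - 10 * ε) * m) ε := by
    intro l
    induction l with
    | zero =>
      intro _
      exact (hT (j + 1) (by omega)).nearlyFull_of_nearlyFull (isEdgeRel_reach he (j + 1)) h1
        (by linarith)
    | succ l ih =>
      intro hl
      exact (hT (j + 2 + l) (by omega)).nearlyFull_of_nearlyFull
        (isEdgeRel_reach he (j + 2 + l)) (ih (by omega)) (by linarith)
  have h3 := h2 (k + 1 - j) (by omega)
  rwa [show j + 2 + (k + 1 - j) = k + 3 by omega] at h3

end Reach

/-! ### Growth from a single edge to positive density -/

section Expansion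

variable {W : Type*} [Fintype W] {G : SimpleGraph W} {V : ℕ → Finset W} {e : W × W} {k : ℕ}
  {p D d L b g m : ℝ}

/-- Within `k + 1` steps a positive proportion of the vertices is reached with positive density. -/
theorem exists_manyOut_reach (he : e ∈ edgesBetween G (V 0) (V 1)) (hk : 3 ≤ k)
    (hG : EdgeBounded G p D) (hdisj : ∀ i j, i < j → j ≤ k + 4 → Disjoint (V i) (V j))
    (ht : ∀ i, i + 2 ≤ k + 4 → ClosesTriangles G (V i) (V (i + 1)) (V (i + 2)) d)
    (hm : ∀ i ≤ k + 4, ((V i).card : ℝ) = m) (hm0 : 0 < m)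
    (hp : 0 < p) (hp1 : p ≤ 1) (hD : 0 < D) (hDL : 10 * D ≤ L) (hL : 1 ≤ L) (hDd : 2 * D ≤ d)
    (hDN : D ≤ p * Fintype.card W) (hb : 6 * p * b ≤ d) (hDb : 4 * D ≤ b)
    (hLb : 32 * D * p * m ≤ L * b) (hg : 1 ≤ g)
    (hg₁ : g ≤ d / (12 * L)) (hg₂ : g ≤ d * b / (72 * L * p * Fintype.card W))
    (hgk : (2 * Fintype.card W * L / p) ^ 2 < g ^ k) :
    ∃ j ≤ k + 1, ManyOut (reach G V e j) (V j) (V (j + 1)) (b / (20 * p)) b := by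
  by_contra hcon
  have hno : ∀ j ≤ k + 1, ¬ ManyOut (reach G V e j) (V j) (V (j + 1)) (b / (20 * p)) b :=
    fun j hj h => hcon ⟨j, hj, h⟩
  set s : ℕ → ℝ := fun j => (relCard (reach G V e j) (V j) (V (j + 1)) : ℝ) with hs
  have hs0 : ∀ j, 0 ≤ s j := fun j => Nat.cast_nonneg _
  have hg0 : 0 ≤ g := zero_le_one.trans hg
  have hgL : g ≤ d / (6 * L) := by
    refine hg₁.trans (div_le_div_of_nonneg_left ?_ ?_ ?_) <;> linarith
  have hstep : ∀ j, j + 3 ≤ k + 4 → j + 2 ≤ k + 1 →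
      s j ≤ 2 * Fintype.card W * L / p ∧ (g * s j ≤ s (j + 1) ∨ g * s j ≤ s (j + 2)) := by
    intro j hj hj'
    refine (growth_or_manyOut (m := m) hG (hdisj _ _ ?_ ?_) (hdisj _ _ ?_ ?_) (hdisj _ _ ?_ ?_)
      (hdisj _ _ ?_ ?_) (isEdgeRel_reach he j) (ht j ?_) (ht (j + 1) ?_) hp hp1 hD hDL hDd hDN hb
      hDb (hm _ ?_) hm0 hLb hg₁ hg₂).resolve_left (hno (j + 2) hj') <;> omega
  -- In-degree at most 1 means unsaturated, as p ≤ 1 ≤ L. This covers the first two steps.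
  have hunsat : ∀ j, j + 2 ≤ k + 4 → (∀ v, (inN (reach G V e j) (V j) v).card ≤ 1) →
      g * s j ≤ s (j + 1) := by
    intro j hj h
    refine le_trans ?_ (sum_card_outN_ge_of_unsaturated (L := L) hG
      (hdisj j (j + 2) (by omega) (by omega)) (isEdgeRel_reach he j) (ht j hj) (by linarith)
      (by linarith) hDd subset_rfl fun v _ => ?_)
    · rw [← relCard_eq_sum_in]
      exact mul_le_mul_of_nonneg_right hgL (hs0 j)
    · have h1 : ((inN (reach G V e j) (V j) v).card : ℝ) ≤ 1 := by exact_mod_cast h v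
      nlinarith
  have h0 : 1 ≤ s 0 := by
    have he' := mem_edgesBetween.1 he
    have : 0 < relCard (reach G V e 0) (V 0) (V 1) := by
      refine Finset.card_pos.2 ⟨e, ?_⟩
      simp only [Finset.mem_filter, Finset.mem_product]
      exact ⟨⟨he'.1, he'.2.1⟩, rfl⟩
    exact Nat.one_le_cast.2 this
  have h1 : g ≤ s 1 := by
    have := hunsat 0 (by omega) fun v => Finset.card_le_one.2 fun x hx y hy => by
      have hx' : (x, v) = e := (mem_inN.1 hx).2
      have hy' : (y, v) = e := (mem_inN.1 hy).2
      exact (Prod.ext_iff.1 (hx'.trans hy'.symm)).1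
    nlinarith
  have h2 : g ^ 2 ≤ s 2 := by
    have := hunsat 1 (by omega) fun v => Finset.card_le_one.2 fun x hx y hy => by
      obtain ⟨-, -, u, hu, -⟩ := (mem_inN.1 hx).2
      obtain ⟨-, -, u', hu', -⟩ := (mem_inN.1 hy).2
      have hx' : (u, x) = e := hu
      have hy' : (u', y) = e := hu'
      exact (Prod.ext_iff.1 (hx'.trans hy'.symm)).2
    nlinarith
  -- A factor g per two steps keeps s_j² ≥ g^(j+2); the surplus 2 comes from the two initial steps.
  -- Growth may skip an index, hence the choice of two values for j.
  have hchain : ∀ l, l + 3 ≤ k →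
      ∃ j, (j = l + 1 ∨ j = l + 2) ∧ g ^ (j + 2) ≤ s j ^ 2 := by
    intro l
    induction l with
    | zero =>
      intro _
      refine ⟨2, Or.inr rfl, ?_⟩
      calc g ^ (2 + 2) = (g ^ 2) ^ 2 := by ring
        _ ≤ s 2 ^ 2 := pow_le_pow_left₀ (by positivity) h2 2
    | succ l ih =>
      intro hl
      obtain ⟨j, rfl | rfl, hj⟩ := ih (by omega)
      · have hmul : ∀ x, g * s (l + 1) ≤ x → g ^ (l + 1 + 2 + 2) ≤ x ^ 2 := fun x hx => by
          calc g ^ (l + 1 + 2 + 2) = g ^ 2 * g ^ (l + 1 + 2) := by ring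
            _ ≤ g ^ 2 * s (l + 1) ^ 2 := mul_le_mul_of_nonneg_left hj (by positivity)
            _ = (g * s (l + 1)) ^ 2 := by ring
            _ ≤ x ^ 2 := pow_le_pow_left₀ (mul_nonneg hg0 (hs0 _)) hx 2
        rcases (hstep (l + 1) (by omega) (by omega)).2 with h | h
        · exact ⟨l + 2, Or.inl rfl, (pow_le_pow_right₀ hg (by omega)).trans (hmul _ h)⟩
        · exact ⟨l + 3, Or.inr rfl, hmul _ h⟩
      · exact ⟨l + 2, Or.inl rfl, hj⟩
  -- Now j is k-2 or k-1: large enough for j+2 ≥ k, small enough for one more application of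
  -- `hstep`.
  obtain ⟨j, hj, hgj⟩ := hchain (k - 3) (by omega)
  have h3 := (hstep j (by omega) (by omega)).1
  have h4 : s j ^ 2 ≤ (2 * Fintype.card W * L / p) ^ 2 := pow_le_pow_left₀ (hs0 j) h3 2
  have h5 : g ^ k ≤ g ^ (j + 2) := pow_le_pow_right₀ hg (by omega)
  linarith

end Expansion

/-! ### From reached edges to copies of the square of a path -/

lemma expands_of_reach {W : Type*} {k : ℕ} {G : SimpleGraph W} {V : Fin (k + 2) → Finset W}
    {V' : ℕ → Finset W} (hV : ∀ i : Fin (k + 2), V' i = V i)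
    (hdisj : ∀ i j, i ≠ j → Disjoint (V i) (V j)) {e : W × W}
    (he : e ∈ edgesBetween G (V' 0) (V' 1)) {E' : Finset (W × W)}
    (hE : ∀ e' ∈ E', reach G V' e k e'.1 e'.2) : Expands G V e E' := by
  intro e' he'
  obtain ⟨f, h0, h1, hk, hk', hfV, hadj⟩ := exists_path_of_reach he k (hE e' he')
  have hmem : ∀ i : Fin (k + 2), f i ∈ V i := fun i => by
    rw [← hV]; exact hfV i (by omega)
  refine ⟨⟨⟨fun i => f i, ?_⟩, ?_⟩, hmem, ?_, ?_⟩
  · rintro i j ⟨hne, h1, h2⟩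
    rcases lt_or_gt_of_ne hne with h | h
    · exact hadj i j h h2 (by omega)
    · exact (hadj j i h h1 (by omega)).symm
  · intro i j hij
    by_contra hne
    refine Finset.disjoint_left.1 (hdisj i j hne) (hmem i) ?_
    have : f i = f j := hij
    rw [this]; exact hmem j
  · exact Prod.ext h0.symm h1.symm
  · exact Prod.ext hk.symm hk'.symm

end PathExpansion

namespace PathExpansion

open Filter Topology
open scoped Classical

/-! ### Asymptotics -/

lemma eventually_mul_rpow_le (C : ℝ) {a b : ℝ} (hab : a < b) :
    ∀ᶠ n : ℕ in atTop, C * (n : ℝ) ^ a ≤ (n : ℝ) ^ b := by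
  have h1 : Tendsto (fun n : ℕ => (n : ℝ) ^ (b - a)) atTop atTop :=
    (tendsto_rpow_atTop (sub_pos.2 hab)).comp tendsto_natCast_atTop_atTop
  filter_upwards [h1.eventually_ge_atTop C, eventually_gt_atTop 0] with n hn hn0
  have hn0' : (0 : ℝ) < n := by exact_mod_cast hn0
  calc C * (n : ℝ) ^ a ≤ (n : ℝ) ^ (b - a) * (n : ℝ) ^ a :=
        mul_le_mul_of_nonneg_right hn (by positivity)
    _ = (n : ℝ) ^ b := by rw [← Real.rpow_add hn0']; congr 1; ring

/-- The inequalities between the parameters of the expansion that hold for large `n`. -/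
lemma eventually_parameters {α η γ δ κ ε : ℝ} {k : ℕ} (hα : 0 < α) (hη : 0 < η)
    (hκ : 0 < κ) (hε : 0 < ε) (hδ : 0 < δ) (hδ1 : δ < 1 / 2) (hδγ : 2 * δ < γ)
    (hk : 3 - γ + 4 * δ < k * (γ - 2 * δ)) :
    ∀ᶠ n : ℕ in atTop, 0 < n ∧ 10 ≤ (n : ℝ) ^ δ ∧ 384 / α ^ 2 ≤ (n : ℝ) ^ δ ∧
      2 * (n : ℝ) ^ δ ≤ η * α ^ 2 / 2 * (n : ℝ) ^ γ ∧
      (n : ℝ) ^ δ ≤ (n : ℝ) ^ (-1 / 2 + γ / 2 : ℝ) * n ∧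
      4 * (n : ℝ) ^ δ ≤ α ^ 2 / 12 * η * ((n : ℝ) ^ (-1 / 2 + γ / 2 : ℝ) * n) ∧
      1 ≤ κ * (n : ℝ) ^ (γ - 2 * δ) ∧
      (2 * n * ((n : ℝ) ^ δ) ^ 2 / (n : ℝ) ^ (-1 / 2 + γ / 2 : ℝ)) ^ 2 <
        (κ * (n : ℝ) ^ (γ - 2 * δ)) ^ k ∧
      1 ≤ ε * (η * n) := by
  have e1 := eventually_mul_rpow_le 10 hδ
  have e2 := eventually_mul_rpow_le (384 / α ^ 2) hδ
  have e3 := eventually_mul_rpow_le (2 / (η * α ^ 2 / 2)) (by linarith : δ < γ)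
  have e4 := eventually_mul_rpow_le 1 (by linarith : δ < -1 / 2 + γ / 2 + 1)
  have e5 := eventually_mul_rpow_le (4 / (α ^ 2 / 12 * η)) (by linarith : δ < -1 / 2 + γ / 2 + 1)
  have e6 := eventually_mul_rpow_le (1 / κ) (by linarith : 0 < γ - 2 * δ)
  have e7 := eventually_mul_rpow_le (5 / κ ^ k) hk
  have e8 := eventually_mul_rpow_le (1 / (ε * η)) (zero_lt_one (α := ℝ))
  filter_upwards [e1, e2, e3, e4, e5, e6, e7, e8, eventually_gt_atTop 0]
    with n h1 h2 h3 h4 h5 h6 h7 h8 hn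
  have hn0 : (0 : ℝ) < n := by exact_mod_cast hn
  rw [Real.rpow_zero, mul_one] at h1 h2 h6 h8
  rw [Real.rpow_one] at h8
  rw [Real.rpow_add hn0, Real.rpow_one] at h4 h5
  refine ⟨hn, h1, h2, ?_, by linarith, ?_, ?_, ?_, ?_⟩
  · rw [div_mul_eq_mul_div, div_le_iff₀ (by positivity)] at h3; linarith
  · rw [div_mul_eq_mul_div, div_le_iff₀ (by positivity)] at h5; linarith
  · rw [div_le_iff₀ (by positivity)] at h6; linarith
  · have hl : (2 * n * ((n : ℝ) ^ δ) ^ 2 / (n : ℝ) ^ (-1 / 2 + γ / 2 : ℝ)) ^ 2 =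
        4 * (n : ℝ) ^ (3 - γ + 4 * δ) := by
      have h9 : (n : ℝ) ^ (3 - γ + 4 * δ) =
          ((n : ℝ) * ((n : ℝ) ^ δ) ^ 2 / (n : ℝ) ^ (-1 / 2 + γ / 2 : ℝ)) ^ 2 := by
        rw [← Real.rpow_natCast ((n : ℝ) ^ δ), ← Real.rpow_mul hn0.le, div_eq_mul_inv,
          ← Real.rpow_neg hn0.le]
        nth_rewrite 2 [← Real.rpow_one (n : ℝ)]
        rw [← Real.rpow_add hn0, ← Real.rpow_add hn0, ← Real.rpow_natCast, ← Real.rpow_mul hn0.le]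
        congr 1; push_cast; ring
      rw [h9]; ring
    have hr : (κ * (n : ℝ) ^ (γ - 2 * δ)) ^ k = κ ^ k * (n : ℝ) ^ (k * (γ - 2 * δ)) := by
      rw [mul_pow, ← Real.rpow_natCast ((n : ℝ) ^ (γ - 2 * δ)), ← Real.rpow_mul hn0.le,
        mul_comm (k : ℝ)]
    rw [hl, hr]
    rw [div_mul_eq_mul_div, div_le_iff₀ (by positivity)] at h7
    have h10 : 0 < (n : ℝ) ^ (3 - γ + 4 * δ) := Real.rpow_pos_of_pos hn0 _
    linarith
  · rw [div_le_iff₀ (by positivity)] at h8; linarith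

/-! ### Expansion in regular blow-ups -/

section BlowUp

variable {W : Type*} {G : SimpleGraph W} {k n₀ : ℕ} {V : Fin (k + 1) → Finset W} {q ε : ℝ}

/-- The vertex sets of a blow-up, as a sequence that is eventually empty. -/
def extendSets (V : Fin (k + 1) → Finset W) (i : ℕ) : Finset W :=
  if h : i < k + 1 then V ⟨i, h⟩ else ∅

lemma extendSets_of_lt {i : ℕ} (h : i < k + 1) : extendSets V i = V ⟨i, h⟩ := dif_pos h

lemma IsTildeBlowUp.closesTriangles (h : IsTildeBlowUp k G V n₀ q ε) {i : ℕ} (hi : i + 2 ≤ k) :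
    ClosesTriangles G (extendSets V i) (extendSets V (i + 1)) (extendSets V (i + 2))
      ((1 - ε) * n₀ * q ^ 2) := by
  rw [extendSets_of_lt (by omega), extendSets_of_lt (by omega), extendSets_of_lt (by omega)]
  exact h.triangles i (by omega)

lemma pathSquare_adj_succ {i : ℕ} (hi : i + 1 ≤ k) :
    (pathSquare k).Adj ⟨i, by omega⟩ ⟨i + 1, by omega⟩ :=
  ⟨by simp, by simp only; omega, by simp only; omega⟩

lemma IsTildeBlowUp.spreadTriple (h : IsTildeBlowUp k G V n₀ q ε) (hn₀ : 0 < n₀) (hq : 0 < q)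
    (hε : 0 < ε) (hε' : ε ≤ 1 / 100) {i : ℕ} (hi : i + 2 ≤ k) :
    SpreadTriple G (extendSets V i) (extendSets V (i + 1)) (extendSets V (i + 2)) q ε n₀ := by
  rw [extendSets_of_lt (by omega), extendSets_of_lt (by omega), extendSets_of_lt (by omega)]
  have hadj := pathSquare_adj_succ (k := k) (i := i) (by omega)
  have hc : ∀ j, ((V j).card : ℝ) = n₀ := fun j => by rw [h.card_eq j]
  exact ⟨(h.regular _ _ hadj).isBalanced hq.le hε' (hc _) (hc _) (h.density_ge _ _ hadj)
    (h.density_le _ _ hadj), hc _, hc _, h.lowerRegular i (by omega), by exact_mod_cast hn₀, hq,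
    hε, hε'⟩

end BlowUp

/-- The deterministic part of the expansion theorem. -/
theorem exists_expands {W : Type*} [Fintype W] {G : SimpleGraph W} {k n₀ : ℕ}
    {V : Fin (k + 4 + 1) → Finset W} {α p D d L b g ε : ℝ} (hα : 0 < α)
    (h : IsTildeBlowUp (k + 4) G V n₀ (α * p) ε) (hε : 0 < ε) (hε₁ : ε ≤ 1 / 100)
    (hε₂ : 64 * ε ≤ α / 12 * (α ^ 2 / 240)) (hk : 3 ≤ k) (hG : EdgeBounded G p D)
    (hp : 0 < p) (hp1 : p ≤ 1) (hd : d = (1 - ε) * n₀ * (α * p) ^ 2) (hb : b = α / 12 * (α * p) * n₀)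
    (hD : 0 < D) (hDL : 10 * D ≤ L) (hL : 1 ≤ L) (hDd : 2 * D ≤ d)
    (hDN : D ≤ p * Fintype.card W) (hDb : 4 * D ≤ b)
    (hLb : 32 * D * p * n₀ ≤ L * b) (hg : 1 ≤ g)
    (hg₁ : g ≤ d / (12 * L)) (hg₂ : g ≤ d * b / (72 * L * p * Fintype.card W))
    (hgk : (2 * Fintype.card W * L / p) ^ 2 < g ^ k) (hm : 1 ≤ ε * n₀)
    {e : W × W} (he : e ∈ edgesBetween G (V 0) (V 1)) :
    ∃ E' ⊆ edgesBetween G (V (Fin.last (k + 3)).castSucc) (V (Fin.last (k + 4))),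
      (0.52 : ℝ) * ((edgesBetween G (V (Fin.last (k + 3)).castSucc)
        (V (Fin.last (k + 4)))).card : ℝ) ≤ (E'.card : ℝ) ∧ Expands G V e E' := by
  have hm0 : (0 : ℝ) < n₀ := pos_of_mul_pos_right (zero_lt_one.trans_le hm) hε.le
  have hn₀ : 0 < n₀ := by exact_mod_cast hm0
  have hq : 0 < α * p := by positivity
  set V' := extendSets V with hV'
  have hV : ∀ i : Fin (k + 4 + 1), V' i = V i := fun i => extendSets_of_lt i.2
  have he' : e ∈ edgesBetween G (V' 0) (V' 1) := by
    have h0 : V' 0 = V 0 := hV 0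
    have h1 : V' 1 = V 1 := hV 1
    rwa [h0, h1]
  have hc : ∀ i ≤ k + 4, ((V' i).card : ℝ) = n₀ := fun i hi => by
    rw [hV', extendSets_of_lt (by omega), h.card_eq]
  obtain ⟨j, hj, hF⟩ := exists_manyOut_reach (m := n₀) he' hk hG (fun i j hij hj => by
      rw [hV', extendSets_of_lt (by omega), extendSets_of_lt (by omega)]
      exact h.disjoint _ _ (by simp; omega)) (fun i hi => by
      rw [hd]; exact h.closesTriangles hi) hc hm0 hp hp1 hD hDL hL hDd hDN (by
      rw [hd, hb]
      have h1 : 0 ≤ n₀ * (α * p) ^ 2 := by positivity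
      nlinarith) hDb hLb hg hg₁ hg₂ hgk
  -- The constants for spreading are therefore c₁ = α/12 and c₂ = α²/240.
  have hb' : b / (20 * p) = α ^ 2 / 240 * n₀ := by rw [hb]; field_simp; norm_num
  rw [hb', hb] at hF
  have hfull := nearlyFull_reach he' (fun i hi => h.spreadTriple hn₀ hq hε hε₁ hi)
    (by positivity) hε₂ hm hj hF
  have hVl : V' (k + 3) = V (Fin.last (k + 3)).castSucc := hV (Fin.last (k + 3)).castSucc
  have hVr : V' (k + 4) = V (Fin.last (k + 4)) := hV (Fin.last (k + 4))
  have hreg : IsRegular G ε (V' (k + 3)) (V' (k + 4)) := by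
    rw [hVl, hVr]
    exact h.regular _ _ (pathSquare_adj_succ (k := k + 4) (i := k + 3) (by omega))
  have hcard := hfull.relCard_ge hreg (hc _ (by omega)) (hc _ (by omega)) hm0.le hε.le hε₁
  rw [← hVl, ← hVr]
  refine ⟨(V' (k + 3) ×ˢ V' (k + 4)).filter fun e' => reach G V' e (k + 3) e'.1 e'.2, ?_, ?_,
    expands_of_reach (k := k + 3) hV h.disjoint he' fun e' h' => (Finset.mem_filter.1 h').2⟩
  · intro e' h'
    exact mem_edgesBetween.2 (isEdgeRel_reach he' (k + 3) _ _ (Finset.mem_filter.1 h').2)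
  · rw [card_edgesBetween]; exact hcard

end PathExpansion

theorem mainTheorem3 (α : ℝ) (hα : 0 < α) :
    ∃ ε₀ : ℝ, 0 < ε₀ ∧ ∀ ε : ℝ, 0 < ε → ε ≤ ε₀ →
      ∀ (η γ : ℝ) (k : ℕ), 0 < η → 0 < γ → 3 / γ ≤ (k : ℝ) →
      ∀ p : ℕ → unitInterval, (∀ n : ℕ, (p n : ℝ) = (n : ℝ) ^ (-1 / 2 + γ / 2 : ℝ)) →
      Filter.Tendsto
        (fun n : ℕ => SimpleGraph.binomialRandom (Fin n) (p n)
          {H : SimpleGraph (Fin n) |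
            ∀ G : SimpleGraph (Fin n), G ≤ H →
            ∀ (n₀ : ℕ) (V : Fin (k + 4 + 1) → Finset (Fin n)), η * (n : ℝ) ≤ (n₀ : ℝ) →
              PathExpansion.IsTildeBlowUp (k + 4) G V n₀ (α * (p n : ℝ)) ε →
              ∀ e ∈ PathExpansion.edgesBetween G (V 0) (V 1),
                ∃ E' ⊆ PathExpansion.edgesBetween G
                    (V (Fin.last (k + 3)).castSucc) (V (Fin.last (k + 4))),
                  (0.52 : ℝ) * ((PathExpansion.edgesBetween G
                    (V (Fin.last (k + 3)).castSucc) (V (Fin.last (k + 4)))).card : ℝ)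
                      ≤ (E'.card : ℝ) ∧
                  PathExpansion.Expands G V e E'})
        Filter.atTop (nhds 1) := by
  -- The second bound is c₁c₂/64 for the constants c₁ = α/12 and c₂ = α²/240 of the dense regime.
  refine ⟨min (1 / 100) (α / 12 * (α ^ 2 / 240) / 64), by positivity, ?_⟩
  intro ε hε hεle η γ k hη hγ hkγ p hp
  have hε₁ : ε ≤ 1 / 100 := hεle.trans (min_le_left _ _)
  have hε₂ : 64 * ε ≤ α / 12 * (α ^ 2 / 240) := by
    have := hεle.trans (min_le_right _ _)
    linarith
  -- For γ > 1 the value at n = 2 would not be a probability.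
  have hγ1 : γ ≤ 1 := by
    by_contra hcon
    have h1 : (1 : ℝ) < (2 : ℕ) ^ (-1 / 2 + γ / 2 : ℝ) :=
      Real.one_lt_rpow (by norm_num) (by linarith [not_le.1 hcon])
    have h2 := (p 2).2.2
    rw [hp 2] at h2
    linarith
  have hkγ' : 3 ≤ k * γ := by rwa [div_le_iff₀ hγ] at hkγ
  have hk : 3 ≤ k := by
    have : (3 : ℝ) ≤ k := by nlinarith
    exact_mod_cast this
  have hk0 : (0 : ℝ) ≤ k := Nat.cast_nonneg k
  -- The exponent of g^k must exceed that of (nL/p)²: 3 - γ + 4δ < k(γ - 2δ). Since kγ ≥ 3, it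
  -- suffices that (2k+4)δ < γ, and this choice makes the left side γ/2.
  set δ : ℝ := γ / (4 * k + 8) with hδdef
  have hδk : (4 * k + 8) * δ = γ := by rw [hδdef]; field_simp
  have hδ : 0 < δ := by positivity
  have hkδ : 0 ≤ k * δ := by positivity
  -- The two terms meet the two upper bounds on g, with 24 = 2·12 and 1728 = 2·12·72.
  set κ : ℝ := min (η * α ^ 2 / 24) (η ^ 2 * α ^ 4 / 1728) with hκdef
  have hκ : 0 < κ := by positivity
  have hev := PathExpansion.eventually_parameters (α := α) (η := η) (γ := γ) (δ := δ) (κ := κ)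
    (ε := ε) (k := k) hα hη hκ hε hδ (by linarith) (by linarith) (by linarith)
  refine PathExpansion.tendsto_binomialRandom_of_edgeBounded p hδ _ ?_
  filter_upwards [hev] with n hn H hH G hGH n₀ V hn₀ hblow e he
  obtain ⟨hn, h10, h384, hDd, hDN, hDb, hg, hgk, hm⟩ := hn
  have hn0 : (0 : ℝ) < n := by exact_mod_cast hn
  rw [← hp n] at hDN hDb hgk
  have hp0 : 0 < (p n : ℝ) := by rw [hp n]; positivity
  have hp2 : (n : ℝ) * (p n : ℝ) ^ 2 = (n : ℝ) ^ γ := by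
    rw [hp n, ← Real.rpow_natCast, ← Real.rpow_mul hn0.le]
    nth_rewrite 1 [← Real.rpow_one (n : ℝ)]
    rw [← Real.rpow_add hn0]
    congr 1; push_cast; ring
  set P : ℝ := (p n : ℝ) with hP
  set D : ℝ := (n : ℝ) ^ δ with hDdef
  have hD0 : 0 < D := by positivity
  have hm0 : (0 : ℝ) < n₀ := lt_of_lt_of_le (by positivity) hn₀
  set d : ℝ := (1 - ε) * n₀ * (α * P) ^ 2 with hd
  set b : ℝ := α / 12 * (α * P) * n₀ with hb
  have hd_ge : η * α ^ 2 / 2 * (n : ℝ) ^ γ ≤ d := by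
    rw [← hp2, hd]
    calc η * α ^ 2 / 2 * ((n : ℝ) * P ^ 2) = 1 / 2 * (η * n) * (α * P) ^ 2 := by ring
      _ ≤ (1 - ε) * n₀ * (α * P) ^ 2 := by
        refine mul_le_mul_of_nonneg_right ?_ (by positivity)
        exact mul_le_mul (by linarith) hn₀ (by positivity) (by linarith)
  have hb_ge : α ^ 2 / 12 * η * (P * n) ≤ b := by
    rw [hb]
    calc α ^ 2 / 12 * η * (P * n) = α / 12 * (α * P) * (η * n) := by ring
      _ ≤ _ := mul_le_mul_of_nonneg_left hn₀ (by positivity)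
  have hsplit : (n : ℝ) ^ (γ - 2 * δ) = (n : ℝ) ^ γ / D ^ 2 := by
    rw [Real.rpow_sub hn0, hDdef, ← Real.rpow_natCast ((n : ℝ) ^ δ), ← Real.rpow_mul hn0.le]
    congr 2; push_cast; ring
  have hnγ : 0 < (n : ℝ) ^ γ := by positivity
  have hdpos : 0 < d := lt_of_lt_of_le (by positivity) hd_ge
  -- With L = D² the ratio L/D tends to infinity, as the gap between the two saturation thresholds
  -- demands, at a cost of only n^(2δ) in the growth factor.
  refine PathExpansion.exists_expands (D := D) (L := D ^ 2) (d := d) (b := b)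
    (g := κ * (n : ℝ) ^ (γ - 2 * δ)) hα hblow hε hε₁ hε₂ hk (hH.mono hGH) hp0 (p n).2.2 hd hb hD0
    (by nlinarith) (by nlinarith) (hDd.trans hd_ge) (by simpa using hDN) (hDb.trans hb_ge) ?_ hg
    ?_ ?_ (by simpa using hgk) (hm.trans (mul_le_mul_of_nonneg_left hn₀ hε.le)) he
  · rw [div_le_iff₀ (by positivity)] at h384
    have h1 : 0 ≤ D * P * n₀ := by positivity
    calc 32 * D * P * n₀ = 384 * (D * P * n₀) / 12 := by ring
      _ ≤ (D * α ^ 2) * (D * P * n₀) / 12 := by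
        have := mul_le_mul_of_nonneg_right h384 h1
        linarith
      _ = D ^ 2 * b := by rw [hb]; ring
  · rw [hsplit]
    calc κ * ((n : ℝ) ^ γ / D ^ 2) ≤ η * α ^ 2 / 24 * ((n : ℝ) ^ γ / D ^ 2) :=
          mul_le_mul_of_nonneg_right (min_le_left _ _) (by positivity)
      _ = (η * α ^ 2 / 2 * (n : ℝ) ^ γ) / (12 * D ^ 2) := by field_simp; norm_num
      _ ≤ d / (12 * D ^ 2) := div_le_div_of_nonneg_right hd_ge (by positivity)
  · rw [hsplit, Fintype.card_fin]
    calc κ * ((n : ℝ) ^ γ / D ^ 2) ≤ η ^ 2 * α ^ 4 / 1728 * ((n : ℝ) ^ γ / D ^ 2) :=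
          mul_le_mul_of_nonneg_right (min_le_right _ _) (by positivity)
      _ = (η * α ^ 2 / 2 * (n : ℝ) ^ γ) * (α ^ 2 / 12 * η * (P * n)) / (72 * D ^ 2 * P * n) := by
          field_simp; norm_num
      _ ≤ d * b / (72 * D ^ 2 * P * n) := by
          refine div_le_div_of_nonneg_right ?_ (by positivity)
          exact mul_le_mul hd_ge hb_ge (by positivity) hdpos.le
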